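/- For a finite group $G$ let $$S(G)=\Big\{\det\big(x_{gh^{-1}}\big)_{g,h\in G}\ :\ x_g\in\mathbb Z\ (g\in G)\Big\}$$ be the set of values of the group determinant of $G$ at integers. Let $\mathcal P_1$ be the set of primes $p\equiv 1 \bmod 12$ with $p=(6k+2)^2+(6t+3)^2$ for some $k,t\in\mathbb Z$, and call a prime $p$ admissible if $p\equiv 5 \bmod 12$, or $p\equiv 7\bmod 12$, or $p\in\mathcal P_1$. Theorem. The set $S(\mathbb Z_{12})$, where $\mathbb Z_{12}$ is the cyclic group of order $12$, is described as follows. (a) The odd elements of $S(\mathbb Z_{12})$ that are coprime to $3$ are exactly the integers coprime to $6$. The odd elements of $S(\mathbb Z_{12})$ that are divisible by $3$ are exactly the integers $9mp$ with $m\in\mathbb Z$ coprime to $6$ and $p$ an admissible prime, together with the integers $27m$ with $m\in\mathbb Z$ odd. (b) The even elements of $S(\mathbb Z_{12})$ that are divisible by $3$ are exactly the integers $2^4\cdot 3^2\,m$ with $m\in\mathbb Z$. The even elements of $S(\mathbb Z_{12})$ that are coprime to $3$ are exactly the integers $2^4m$ with $m\in\mathbb Z$ coprime to $6$, the integers $2^5mp$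 with $m\in\mathbb Z$ coprime to $6$ and $p$ an admissible prime, and the integers $2^6m$ with $m\in\mathbb Z$ coprime to $3$. -/

import Mathlib

/-- The group determinant: the determinant of the matrix, with rows and columns indexed by `G`,
whose `(g, h)` entry is `x (g * h⁻¹)`. -/
def groupDet {G : Type*} [Group G] [Fintype G] [DecidableEq G] (x : G → ℤ) : ℤ :=
  (Matrix.of fun g h : G => x (g * h⁻¹)).det

/-- The set of integers that are values of the group determinant of `G` at integers. -/
def groupDetValues (G : Type*) [Group G] [Fintype G] [DecidableEq G] : Set ℤ :=
  {n | ∃ x : G → ℤ, groupDet x = n}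

/-- The primes `p ≡ 1 mod 12` of the form `(6k+2)² + (6t+3)²`. -/
def primesP1 : Set ℕ :=
  {p | p.Prime ∧ p ≡ 1 [MOD 12] ∧ ∃ k t : ℤ, (p : ℤ) = (6 * k + 2) ^ 2 + (6 * t + 3) ^ 2}

/-- The primes `p` with `p ≡ 5 mod 12`, or `p ≡ 7 mod 12`, or `p ∈ primesP1`. -/
def admissiblePrimes : Set ℕ :=
  {p | p.Prime ∧ (p ≡ 5 [MOD 12] ∨ p ≡ 7 [MOD 12] ∨ p ∈ primesP1)}

/-!
Write `F` for an element of `ℤ[C₁₂] = ℤ[C₄][C₃]`. Its determinant is the product of the values of `F`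
at the twelve characters, and grouping the characters by order gives
`D = (N₁ N₂) N₄ (N₃ N₆) N₁₂`, where `N₁ N₂ = p² - q²`, `N₄ = u² + v²` is the norm of the Gaussian
integer `u + v i` (the value at a character of order `4`), `N₃ N₆` is a norm from `ℤ[ω]`, and
`N₁₂ = re² + im²` is the norm of the relative norm `γ = re + im i ∈ ℤ[i]` of the value at a character
of order `12`. The structure `CharData` records these values, and `mem_groupDetValues_iff` says that
congruences modulo `2` and `3` are the only constraints on them.

The congruences force divisibility by `9` (`CharData.nine_dvd_det`) and `16`
(`CharData.sixteen_dvd_det`). Beyond that there are two relations: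

* modulo `2`, the relative norm `γ` is congruent to `1` or to `i` according as the odd number `N₃ N₆`
  is `1` or `3` modulo `4` (`CharData.eis_emod_four`);
* modulo `3`, `γ ≡ (u + v i)²` (`CharData.re_modEq_three`, `CharData.im_modEq_three`).

If no admissible prime divides `D`, then every Gaussian integer whose norm divides `D` and is coprime
to `6` is congruent to a unit modulo `6` (`six_dvd_or_of_sq_add_sq`): a Gaussian prime of norm `p` is
congruent to a unit modulo `6` precisely when `p` is `1` modulo `12` and not in `primesP1`. Moreover
every norm from `ℤ[ω]` that divides `D` and is coprime to `6` is `1` modulo `4`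
(`eisNorm_mod_four`), since its prime factors that are `2` modulo `3` occur to even powers. When `9`
exactly divides an odd `D`, so that `N₃ N₆` is `3` times such a norm, the first relation gives
`γ ≡ i` modulo `2` and the second gives `γ ≡ ±1` modulo `3`; when `2⁵` exactly divides a `D` coprime
to `3`, they give `γ ≡ 1` modulo `2` and `γ ≡ ±i` modulo `3`. Either way `γ` is not congruent to a
unit modulo `6`, a contradiction.

Conversely, all listed values are attained by explicit families, combined by multiplicativity
(`mul_mem_groupDetValues`). For an admissible prime `p` one needs an element of norm `p` in `ℤ[i]`,
`ℤ[ω]` or `ℤ[ω, i]` as `p` is `5` modulo `12`, `7` modulo `12` or in `primesP1`. The last two exist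
because `ℤ[ω]` and `ℤ[ω, i]` are Euclidean for the norm, which rests on the rounding lemma
`exists_two_mul_eisNorm_sub_lt`; multiplication by units then adjusts the residue of the element
modulo `2` and modulo `√-3` (`exists_relNorm_normalized`).
-/

/-! ### The determinant as a product over characters -/

theorem groupDet_mul {G : Type*} [Group G] [Fintype G] [DecidableEq G] (x y : G → ℤ) :
    groupDet x * groupDet y = groupDet fun g => ∑ k, x (g * k⁻¹) * y k := by
  unfold groupDet
  rw [← Matrix.det_mul]
  congr 1
  ext g h
  simp only [Matrix.mul_apply, Matrix.of_apply]
  refine (Fintype.sum_equiv (Equiv.mulRight h) _ _ fun k => ?_).symm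
  simp [mul_assoc]

theorem mul_mem_groupDetValues {G : Type*} [Group G] [Fintype G] [DecidableEq G] {m n : ℤ}
    (hm : m ∈ groupDetValues G) (hn : n ∈ groupDetValues G) : m * n ∈ groupDetValues G := by
  obtain ⟨x, rfl⟩ := hm
  obtain ⟨y, rfl⟩ := hn
  exact ⟨_, (groupDet_mul x y).symm⟩

/-- The characters diagonalize the group matrix: its eigenvectors are the columns of a Vandermonde
matrix. -/
theorem groupDet_zmod_eq_prod {n : ℕ} [NeZero n] {ζ : ℂ} (hζ : IsPrimitiveRoot ζ n)
    (x : Multiplicative (ZMod n) → ℤ) :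
    (groupDet x : ℂ) = ∏ j : Fin n, ∑ k : ZMod n,
      (x (Multiplicative.ofAdd k) : ℂ) * (ζ ^ (j : ℕ)) ^ k.val := by
  let e : Fin n ≃ ZMod n := (ZMod.finEquiv n).toEquiv
  let V : Matrix (ZMod n) (ZMod n) ℂ :=
    Matrix.of fun h j => ((ζ ^ (e.symm j : ℕ)) ^ h.val)⁻¹
  let M : Matrix (ZMod n) (ZMod n) ℂ :=
    Matrix.of fun g h => (x (Multiplicative.ofAdd (g - h)) : ℂ)
  let F : ZMod n → ℂ := fun j => ∑ k : ZMod n,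
      (x (Multiplicative.ofAdd k) : ℂ) * (ζ ^ (e.symm j : ℕ)) ^ k.val
  have hζ0 : ζ ≠ 0 := hζ.ne_zero (NeZero.ne n)
  have hpow (j : ZMod n) (a b : ZMod n) : (ζ ^ (e.symm j : ℕ)) ^ (a + b).val =
      (ζ ^ (e.symm j : ℕ)) ^ a.val * (ζ ^ (e.symm j : ℕ)) ^ b.val := by
    rw [ZMod.val_add, ← pow_add]
    refine (pow_eq_pow_mod _ ?_).symm
    rw [← pow_mul, mul_comm, pow_mul, hζ.pow_eq_one, one_pow]
  have hM : (groupDet x : ℂ) = M.det := by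
    unfold groupDet
    rw [Int.cast_det,
      ← Matrix.det_submatrix_equiv_self (Multiplicative.ofAdd : ZMod n ≃ Multiplicative (ZMod n))]
    congr 1
    ext g h
    change (x (Multiplicative.ofAdd (g + -h)) : ℂ) = x (Multiplicative.ofAdd (g - h))
    rw [sub_eq_add_neg]
  have hMV : M * V = V * Matrix.diagonal F := by
    ext g j
    rw [Matrix.mul_diagonal, Matrix.mul_apply]
    simp only [M, V, F, Matrix.of_apply, Finset.mul_sum]
    refine Fintype.sum_equiv (Equiv.subLeft g) _ _ fun h => ?_
    have hz : ∀ i : ZMod n, (ζ ^ (e.symm j : ℕ)) ^ i.val ≠ 0 := fun i =>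
      pow_ne_zero _ (pow_ne_zero _ hζ0)
    have := hpow j (g - h) h
    rw [sub_add_cancel] at this
    simp only [Equiv.subLeft_apply]
    rw [this]
    field_simp [hz]
  have hV : V.det ≠ 0 := by
    let v : Fin n → ℂ := fun j => (ζ ^ (j : ℕ))⁻¹
    have : V.det = (Matrix.vandermonde v).det := by
      rw [← Matrix.det_transpose, ← Matrix.det_submatrix_equiv_self e]
      congr 1
      ext j h
      have : (e h).val = (h : ℕ) := by
        simp only [e]
        cases n with
        | zero => exact absurd rfl (NeZero.ne 0)
        | succ n => rfl
      simp [V, v, Matrix.vandermonde_apply, this]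
    rw [this, Matrix.det_vandermonde_ne_zero_iff]
    intro i j hij
    exact Fin.ext (hζ.pow_inj i.2 j.2 (inv_injective hij))
  have hdet := congrArg Matrix.det hMV
  rw [Matrix.det_mul, Matrix.det_mul, Matrix.det_diagonal, mul_comm] at hdet
  rw [hM, mul_left_cancel₀ hV hdet]
  exact Fintype.prod_equiv e.symm _ _ fun j => by rfl

/-! ### Values at the characters of `ZMod 12` -/

/-- The norm form of the Eisenstein integers: `eisNorm a b` is the norm of `a + b ω`. -/
def eisNorm (a b : ℤ) : ℤ := a ^ 2 - a * b + b ^ 2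

/-- The real part of the relative norm to `ℤ[i]` of `(a₀ + a₁ ω) + (b₀ + b₁ ω) i`. -/
def relNormRe (a₀ a₁ b₀ b₁ : ℤ) : ℤ := eisNorm a₀ a₁ - eisNorm b₀ b₁

/-- The imaginary part of the relative norm to `ℤ[i]` of `(a₀ + a₁ ω) + (b₀ + b₁ ω) i`. -/
def relNormIm (a₀ a₁ b₀ b₁ : ℤ) : ℤ := 2 * a₀ * b₀ - a₀ * b₁ - a₁ * b₀ + 2 * a₁ * b₁

/-- The values of an integral function on `ZMod 12` at the characters, in integer coordinates. Write
the function as `∑ yʲ Aⱼ` at the trivial character of `C₃` and `∑ yʲ Bⱼ` at a nontrivial one, where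
`y` generates `C₄`, `Aⱼ ∈ ℤ` and `Bⱼ ∈ ℤ[ω]`. Then `p = A₀ + A₂`, `q = A₁ + A₃`, `u = A₀ - A₂`,
`v = A₁ - A₃`, and likewise `s = B₀ + B₂`, `t = B₁ + B₃`, `a = B₀ - B₂`, `b = B₁ - B₃`, with
`s = s₀ + s₁ ω` and so on. The congruences modulo `2` say that the `Aⱼ` and `Bⱼ` are integral, those
modulo `3` that `Aⱼ ≡ Bⱼ` modulo `√-3`. -/
structure CharData where
  (p q u v s₀ s₁ t₀ t₁ a₀ a₁ b₀ b₁ : ℤ)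
  two_dvd_p : 2 ∣ p - u
  two_dvd_q : 2 ∣ q - v
  two_dvd_s₀ : 2 ∣ s₀ - a₀
  two_dvd_s₁ : 2 ∣ s₁ - a₁
  two_dvd_t₀ : 2 ∣ t₀ - b₀
  two_dvd_t₁ : 2 ∣ t₁ - b₁
  three_dvd_p : 3 ∣ p - s₀ - s₁
  three_dvd_q : 3 ∣ q - t₀ - t₁
  three_dvd_u : 3 ∣ u - a₀ - a₁
  three_dvd_v : 3 ∣ v - b₀ - b₁

namespace CharData

/-- The product of the norms of the values `s + t` and `s - t` at characters of order `3` and `6`. -/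
def eis (d : CharData) : ℤ :=
  eisNorm (d.s₀ + d.t₀) (d.s₁ + d.t₁) * eisNorm (d.s₀ - d.t₀) (d.s₁ - d.t₁)

/-- The real part of the relative norm to `ℤ[i]` of the value at a character of order `12`. -/
def re (d : CharData) : ℤ := relNormRe d.a₀ d.a₁ d.b₀ d.b₁

/-- The imaginary part of the relative norm to `ℤ[i]` of the value at a character of order `12`. -/
def im (d : CharData) : ℤ := relNormIm d.a₀ d.a₁ d.b₀ d.b₁

/-- The product of the values at all twelve characters. -/
def det (d : CharData) : ℤ :=
  (d.p ^ 2 - d.q ^ 2) * (d.u ^ 2 + d.v ^ 2) * d.eis * (d.re ^ 2 + d.im ^ 2)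

end CharData

/-- Twelfth roots of unity are products of a fourth and a cube root of unity; accordingly the powers
of `a * b` split along `ZMod 12 ≃ ZMod 4 × ZMod 3`. -/
theorem sum_zmod_twelve_mul_pow {a b : ℂ} (ha : a ^ 4 = 1) (hb : b ^ 3 = 1) (y : ZMod 12 → ℤ) :
    ∑ k : ZMod 12, (y k : ℂ) * (a * b) ^ k.val =
      (y 0 + y 4 * b + y 8 * b ^ 2) + (y 9 + y 1 * b + y 5 * b ^ 2) * a +
      (y 6 + y 10 * b + y 2 * b ^ 2) * a ^ 2 + (y 3 + y 7 * b + y 11 * b ^ 2) * a ^ 3 := by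
  have hsum (f : ZMod 12 → ℂ) : ∑ k, f k = f 0 + f 1 + f 2 + f 3 + f 4 + f 5 + f 6 + f 7 + f 8 +
      f 9 + f 10 + f 11 := by
    have (g : Fin 12 → ℂ) : ∑ k, g k = g 0 + g 1 + g 2 + g 3 + g 4 + g 5 + g 6 + g 7 + g 8 +
        g 9 + g 10 + g 11 := by
      rw [Fin.sum_univ_castSucc, Fin.sum_univ_castSucc, Fin.sum_univ_castSucc,
        Fin.sum_univ_castSucc, Fin.sum_univ_eight]
      rfl
    exact this f
  have h3 : (a * b) ^ 3 = a ^ 3 := by rw [mul_pow, hb, mul_one]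
  have h4 : (a * b) ^ 4 = b := by rw [mul_pow, ha]; linear_combination b * hb
  rw [hsum]
  change y 0 * (a * b) ^ 0 + y 1 * (a * b) ^ 1 + y 2 * (a * b) ^ 2 + y 3 * (a * b) ^ 3 +
    y 4 * (a * b) ^ 4 + y 5 * (a * b) ^ (4 + 1) + y 6 * (a * b) ^ (4 + 2) +
    y 7 * (a * b) ^ (4 + 3) + y 8 * (a * b) ^ (4 + 4) + y 9 * (a * b) ^ (4 + 4 + 1) +
    y 10 * (a * b) ^ (4 + 4 + 2) + y 11 * (a * b) ^ (4 + 4 + 3) = _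
  simp only [pow_add (a * b), h3, h4]
  linear_combination (y 6 * a ^ 2 + y 9 * a + y 10 * a ^ 2 * b) * hb

/-- The factorization of the determinant: the twelve linear factors are grouped into the norms of
the values at characters of each order. -/
theorem groupDet_zmod_twelve (x : Multiplicative (ZMod 12) → ℤ) (y : ZMod 12 → ℤ)
    (hy : ∀ k, y k = x (Multiplicative.ofAdd k)) (d : CharData)
    (hp : d.p = y 0 + y 4 + y 8 + (y 6 + y 10 + y 2))
    (hq : d.q = y 9 + y 1 + y 5 + (y 3 + y 7 + y 11))
    (hu : d.u = y 0 + y 4 + y 8 - (y 6 + y 10 + y 2))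
    (hv : d.v = y 9 + y 1 + y 5 - (y 3 + y 7 + y 11))
    (hs₀ : d.s₀ = y 0 - y 8 + (y 6 - y 2)) (hs₁ : d.s₁ = y 4 - y 8 + (y 10 - y 2))
    (ht₀ : d.t₀ = y 9 - y 5 + (y 3 - y 11)) (ht₁ : d.t₁ = y 1 - y 5 + (y 7 - y 11))
    (ha₀ : d.a₀ = y 0 - y 8 - (y 6 - y 2)) (ha₁ : d.a₁ = y 4 - y 8 - (y 10 - y 2))
    (hb₀ : d.b₀ = y 9 - y 5 - (y 3 - y 11)) (hb₁ : d.b₁ = y 1 - y 5 - (y 7 - y 11)) :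
    groupDet x = d.det := by
  obtain ⟨ζ, hζ⟩ : ∃ ζ : ℂ, IsPrimitiveRoot ζ 12 :=
    ⟨_, Complex.isPrimitiveRoot_exp 12 (by norm_num)⟩
  have hdet := groupDet_zmod_eq_prod hζ x
  obtain ⟨i, hi⟩ : ∃ i, i = ζ ^ 9 := ⟨_, rfl⟩
  obtain ⟨w, hw⟩ : ∃ w, w = ζ ^ 4 := ⟨_, rfl⟩
  have h6 : ζ ^ 6 = -1 := by
    have h1 : (ζ ^ 6 - 1) * (ζ ^ 6 + 1) = 0 := by linear_combination hζ.pow_eq_one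
    rcases mul_eq_zero.1 h1 with h | h
    · exact absurd (sub_eq_zero.1 h) (hζ.pow_ne_one_of_pos_of_lt (by norm_num) (by norm_num))
    · exact eq_neg_of_add_eq_zero_left h
  have hi2 : i ^ 2 = -1 := by
    rw [hi]; linear_combination (ζ ^ 12 - ζ ^ 6 + 1) * h6
  have hw1 : 1 + w + w ^ 2 = 0 := by
    have h1 : (w - 1) * (1 + w + w ^ 2) = 0 := by
      rw [hw]; linear_combination hζ.pow_eq_one
    rcases mul_eq_zero.1 h1 with h | h
    · exact absurd (hw ▸ sub_eq_zero.1 h)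
        (hζ.pow_ne_one_of_pos_of_lt (by norm_num) (by norm_num))
    · exact h
  have hz : ζ = i * w := by
    rw [hw, hi]; linear_combination (-ζ) * hζ.pow_eq_one
  have i4 : i ^ 4 = 1 := by linear_combination (i ^ 2 - 1) * hi2
  have w3 : w ^ 3 = 1 := by linear_combination (w - 1) * hw1
  have hj (j : ℕ) : ∑ k : ZMod 12, (x (Multiplicative.ofAdd k) : ℂ) * (ζ ^ j) ^ k.val =
      (y 0 + y 4 * w ^ j + y 8 * (w ^ j) ^ 2) +
      (y 9 + y 1 * w ^ j + y 5 * (w ^ j) ^ 2) * i ^ j +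
      (y 6 + y 10 * w ^ j + y 2 * (w ^ j) ^ 2) * (i ^ j) ^ 2 +
      (y 3 + y 7 * w ^ j + y 11 * (w ^ j) ^ 2) * (i ^ j) ^ 3 := by
    rw [← sum_zmod_twelve_mul_pow (by rw [pow_right_comm, i4, one_pow])
      (by rw [pow_right_comm, w3, one_pow]), ← mul_pow, ← hz]
    simp_rw [hy]
  have hprod (f : ℕ → ℂ) : ∏ j : Fin 12, f j = (f 0 * f 6) * (f 3 * f 9) *
      ((f 4 * f 8) * (f 2 * f 10)) * ((f 1 * f 5) * (f 7 * f 11)) := by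
    rw [Fin.prod_univ_castSucc, Fin.prod_univ_castSucc, Fin.prod_univ_castSucc,
      Fin.prod_univ_castSucc, Fin.prod_univ_eight]
    simp only [Fin.val_castSucc, Fin.val_last, Fin.isValue, Fin.coe_ofNat_eq_mod]
    norm_num
    ring
  have w2 : w ^ 2 = -1 - w := by linear_combination hw1
  have w2' : (-1 - w) ^ 2 = w := by linear_combination hw1
  have i3 : i ^ 3 = -i := by linear_combination i * hi2
  have ip (r l : ℕ) : i ^ (r + 4 * l) = i ^ r := by
    rw [pow_add, pow_mul, i4, one_pow, mul_one]
  have wp (r l : ℕ) : w ^ (r + 3 * l) = w ^ r := by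
    rw [pow_add, pow_mul, w3, one_pow, mul_one]
  have hE {j : ℕ} {a a₂ a₃ b b₂ : ℂ} (ha : i ^ j = a) (hb : w ^ j = b) (ha₂ : a ^ 2 = a₂)
      (ha₃ : a ^ 3 = a₃) (hb₂ : b ^ 2 = b₂) :
      ∑ k : ZMod 12, (x (Multiplicative.ofAdd k) : ℂ) * (ζ ^ j) ^ k.val =
      (y 0 + y 4 * b + y 8 * b₂) + (y 9 + y 1 * b + y 5 * b₂) * a +
      (y 6 + y 10 * b + y 2 * b₂) * a₂ + (y 3 + y 7 * b + y 11 * b₂) * a₃ := by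
    rw [hj, ha, hb, ha₂, ha₃, hb₂]
  have hi2' : (-i) ^ 2 = -1 := by linear_combination hi2
  have i3' : (-i) ^ 3 = i := by linear_combination -i3
  have i0 : i ^ 0 = 1 := pow_zero i
  have i1 : i ^ 1 = i := pow_one i
  have w0 : w ^ 0 = 1 := pow_zero w
  have w1 : w ^ 1 = w := pow_one w
  have o2 : (1 : ℂ) ^ 2 = 1 := one_pow 2
  have o3 : (1 : ℂ) ^ 3 = 1 := one_pow 3
  have m2 : (-1 : ℂ) ^ 2 = 1 := by norm_num
  have m3 : (-1 : ℂ) ^ 3 = -1 := by norm_num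
  -- complex conjugate characters are paired, in the order of the factors of `CharData.det`
  replace hdet := hdet.trans
    (hprod fun j => ∑ k : ZMod 12, (x (Multiplicative.ofAdd k) : ℂ) * (ζ ^ j) ^ k.val)
  beta_reduce at hdet
  rw [hE (j := 0) ((ip 0 0).trans i0) ((wp 0 0).trans w0) o2 o3 o2,
    hE (j := 6) ((ip 2 1).trans hi2) ((wp 0 2).trans w0) m2 m3 o2,
    hE (j := 3) ((ip 3 0).trans i3) ((wp 0 1).trans w0) hi2' i3' o2,
    hE (j := 9) ((ip 1 2).trans i1) ((wp 0 3).trans w0) hi2 i3 o2,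
    hE (j := 4) ((ip 0 1).trans i0) ((wp 1 1).trans w1) o2 o3 w2,
    hE (j := 8) ((ip 0 2).trans i0) ((wp 2 2).trans w2) o2 o3 w2',
    hE (j := 2) ((ip 2 0).trans hi2) ((wp 2 0).trans w2) m2 m3 w2',
    hE (j := 10) ((ip 2 2).trans hi2) ((wp 1 3).trans w1) m2 m3 w2,
    hE (j := 1) ((ip 1 0).trans i1) ((wp 1 0).trans w1) hi2 i3 w2,
    hE (j := 5) ((ip 1 1).trans i1) ((wp 2 1).trans w2) hi2 i3 w2',
    hE (j := 7) ((ip 3 1).trans i3) ((wp 1 2).trans w1) hi2' i3' w2,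
    hE (j := 11) ((ip 3 2).trans i3) ((wp 2 3).trans w2) hi2' i3' w2'] at hdet
  apply Int.cast_injective (α := ℂ)
  rw [hdet]
  have hi (a b : ℂ) : (a - b * i) * (a + b * i) = a ^ 2 + b ^ 2 := by
    linear_combination -b ^ 2 * hi2
  have he (a b : ℂ) : (a + b * w) * (a + b * (-1 - w)) = a ^ 2 - a * b + b ^ 2 := by
    linear_combination -b ^ 2 * hw1
  have hr (a a' b b' j : ℂ) (h : j ^ 2 = -1) :
      (a + a' * w + (b + b' * w) * j) * (a + a' * (-1 - w) + (b + b' * (-1 - w)) * j) =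
      (a ^ 2 - a * a' + a' ^ 2 - (b ^ 2 - b * b' + b' ^ 2)) +
        (2 * a * b - a * b' - a' * b + 2 * a' * b') * j := by
    linear_combination (-a' ^ 2 - 2 * j * a' * b' + b' ^ 2) * hw1 +
      (b + b' * w) * (b + b' * (-1 - w)) * h
  have hn (a a' b b' : ℂ) :
      (a + a' * w + (b + b' * w) * i) * (a + a' * (-1 - w) + (b + b' * (-1 - w)) * i) *
        ((a + a' * w + (b + b' * w) * (-i)) * (a + a' * (-1 - w) + (b + b' * (-1 - w)) * (-i))) =
      (a ^ 2 - a * a' + a' ^ 2 - (b ^ 2 - b * b' + b' ^ 2)) ^ 2 +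
        (2 * a * b - a * b' - a' * b + 2 * a' * b') ^ 2 := by
    rw [hr _ _ _ _ _ hi2, hr _ _ _ _ _ hi2']
    linear_combination -(2 * a * b - a * b' - a' * b + 2 * a' * b') ^ 2 * hi2
  simp only [CharData.det, CharData.eis, CharData.re, CharData.im, relNormRe, relNormIm, eisNorm]
  rw [hp, hq, hu, hv, hs₀, hs₁, ht₀, ht₁, ha₀, ha₁, hb₀, hb₁]
  push_cast
  refine congrArg₂ (· * ·) (congrArg₂ (· * ·) (congrArg₂ (· * ·) ?_ ?_)
    (congrArg₂ (· * ·) ?_ ?_)) ?_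
  · ring
  · rw [← hi]; ring
  · refine Eq.trans ?_ (he _ _)
    exact congrArg₂ (· * ·) (by ring) (by ring)
  · refine (mul_comm _ _).trans (Eq.trans ?_ (he _ _))
    exact congrArg₂ (· * ·) (by ring) (by ring)
  · refine Eq.trans ?_ (hn _ _ _ _)
    refine congrArg₂ (· * ·) (congrArg₂ (· * ·) ?_ ?_) (congrArg₂ (· * ·) ?_ ?_) <;> ring

/-- Any integers satisfying the congruences of `CharData` come from an integral function: the
inverse of the discrete Fourier transform has denominators `2` and `3` only. -/
theorem mem_groupDetValues_iff {n : ℤ} :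
    n ∈ groupDetValues (Multiplicative (ZMod 12)) ↔ ∃ d : CharData, d.det = n := by
  constructor
  · rintro ⟨x, rfl⟩
    obtain ⟨y, hy⟩ : ∃ y : ZMod 12 → ℤ, ∀ k, y k = x (Multiplicative.ofAdd k) :=
      ⟨_, fun _ => rfl⟩
    refine ⟨⟨_, _, _, _, _, _, _, _, _, _, _, _, ⟨y 6 + y 10 + y 2, ?_⟩,
      ⟨y 3 + y 7 + y 11, ?_⟩, ⟨y 6 - y 2, ?_⟩, ⟨y 10 - y 2, ?_⟩, ⟨y 3 - y 11, ?_⟩,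
      ⟨y 7 - y 11, ?_⟩, ⟨y 8 + y 2, ?_⟩, ⟨y 5 + y 11, ?_⟩, ⟨y 8 - y 2, ?_⟩, ⟨y 5 - y 11, ?_⟩⟩,
      (groupDet_zmod_twelve x y hy _ rfl rfl rfl rfl rfl rfl rfl rfl rfl rfl rfl rfl).symm⟩
    all_goals ring
  · rintro ⟨d, rfl⟩
    obtain ⟨A₂, hA₂⟩ := d.two_dvd_p
    obtain ⟨A₃, hA₃⟩ := d.two_dvd_q
    obtain ⟨B₂, hB₂⟩ := d.two_dvd_s₀
    obtain ⟨B₂', hB₂'⟩ := d.two_dvd_s₁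
    obtain ⟨B₃, hB₃⟩ := d.two_dvd_t₀
    obtain ⟨B₃', hB₃'⟩ := d.two_dvd_t₁
    have kp := d.three_dvd_p
    have kq := d.three_dvd_q
    obtain ⟨m₀, hm₀⟩ := d.three_dvd_u
    obtain ⟨m₁, hm₁⟩ := d.three_dvd_v
    obtain ⟨c₂, hc₂⟩ : 3 ∣ A₂ - B₂ - B₂' := by lia
    obtain ⟨c₃, hc₃⟩ : 3 ∣ A₃ - B₃ - B₃' := by lia
    obtain ⟨c₀, hc₀⟩ : ∃ c₀, c₀ = m₀ + c₂ := ⟨_, rfl⟩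
    obtain ⟨c₁, hc₁⟩ : ∃ c₁, c₁ = m₁ + c₃ := ⟨_, rfl⟩
    let z : Fin 12 → ℤ := ![d.a₀ + B₂ + c₀, d.b₁ + B₃' + c₁, c₂, B₃ + c₃, d.a₁ + B₂' + c₀, c₁,
      B₂ + c₂, B₃' + c₃, c₀, d.b₀ + B₃ + c₁, B₂' + c₂, c₃]
    let y : ZMod 12 → ℤ := z
    have h0 : y 0 = d.a₀ + B₂ + c₀ := rfl
    have h1 : y 1 = d.b₁ + B₃' + c₁ := rfl
    have h2 : y 2 = c₂ := rfl
    have h3 : y 3 = B₃ + c₃ := rfl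
    have h4 : y 4 = d.a₁ + B₂' + c₀ := rfl
    have h5 : y 5 = c₁ := rfl
    have h6 : y 6 = B₂ + c₂ := rfl
    have h7 : y 7 = B₃' + c₃ := rfl
    have h8 : y 8 = c₀ := rfl
    have h9 : y 9 = d.b₀ + B₃ + c₁ := rfl
    have h10 : y 10 = B₂' + c₂ := rfl
    have h11 : y 11 = c₃ := rfl
    refine ⟨fun k => y k.toAdd, groupDet_zmod_twelve _ y (fun _ => rfl) d
      ?_ ?_ ?_ ?_ ?_ ?_ ?_ ?_ ?_ ?_ ?_ ?_⟩
    all_goals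
      simp only [h0, h1, h2, h3, h4, h5, h6, h7, h8, h9, h10, h11]
      clear_value y
      linarith

/-! ### The Euclidean rings `ℤ[ω]` and `ℤ[ω, i]` -/

theorem isPrincipalIdealRing_of_forall_exists_lt {R : Type*} [CommRing R] (N : R → ℕ)
    (h : ∀ a b : R, b ≠ 0 → ∃ q, N (a - b * q) < N b) : IsPrincipalIdealRing R := by
  refine ⟨fun I => ?_⟩
  by_cases hI : ∀ x ∈ I, x = 0
  · exact ⟨0, by ext x; simpa using ⟨fun hx => hI x hx, fun hx => hx ▸ I.zero_mem⟩⟩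
  push Not at hI
  obtain ⟨b, ⟨hbI, hb⟩, hmin⟩ :=
    (measure N).wf.has_min {x | x ∈ I ∧ x ≠ 0} hI
  refine ⟨b, le_antisymm (fun a ha => ?_) ?_⟩
  · obtain ⟨q, hq⟩ := h a b hb
    have h0 : a - b * q = 0 := by
      by_contra h0
      exact hmin _ ⟨I.sub_mem ha (I.mul_mem_right q hbI), h0⟩ hq
    exact Ideal.mem_span_singleton.2 ⟨q, sub_eq_zero.1 h0⟩
  · exact (Ideal.span_singleton_le_iff_mem I).2 hbI

/-- Every point of `ℚ(ω)` is at squared distance less than `1 / 2` from `ℤ[ω]`. The sharp bound is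
`1 / 3`; a bound of at least `1 / 2` would not suffice for `ℤ[ω, i]`. -/
theorem exists_two_mul_eisNorm_sub_lt {n : ℤ} (hn : 0 < n) (a b : ℤ) :
    ∃ q r : ℤ, 2 * eisNorm (a - n * q) (b - n * r) < n ^ 2 := by
  have hround (a : ℤ) : ∃ q : ℤ, 2 * (a - n * q) ≤ n ∧ -n ≤ 2 * (a - n * q) := by
    refine ⟨(2 * a + n) / (2 * n), ?_, ?_⟩
    · have := Int.lt_ediv_add_one_mul_self (2 * a + n) (by lia : 0 < 2 * n)
      nlinarith
    · have := Int.ediv_mul_le (2 * a + n) (by lia : 2 * n ≠ 0)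
      nlinarith
  -- After coordinatewise rounding only coordinates of opposite signs can fail; then `x - n` in place
  -- of `x`, or `n - z` in place of `-z`, does better.
  have key (x z : ℤ) (hx : 0 ≤ x) (hz : 0 ≤ z) (hxn : 2 * x ≤ n) (hzn : 2 * z ≤ n)
      (h1 : n ^ 2 ≤ 2 * eisNorm x (-z)) (h2 : n ^ 2 ≤ 2 * eisNorm (x - n) (-z))
      (h3 : n ^ 2 ≤ 2 * eisNorm x (-z + n)) : False := by
    simp only [eisNorm] at h1 h2 h3
    have h4 : 0 ≤ (n - 2 * x) * (n - 2 * z) := mul_nonneg (by lia) (by lia)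
    have h5 : 2 * (x + z) ≤ n := by
      by_contra! h
      have : 0 < (2 * (x + z) - n) * (3 * n - 2 * (x + z)) := mul_pos (by lia) (by lia)
      nlinarith
    nlinarith [mul_nonneg hx hz]
  obtain ⟨q, hq1, hq2⟩ := hround a
  obtain ⟨r, hr1, hr2⟩ := hround b
  by_contra! hcon
  obtain ⟨x, hx⟩ : ∃ x, x = a - n * q := ⟨_, rfl⟩
  obtain ⟨y, hy⟩ : ∃ y, y = b - n * r := ⟨_, rfl⟩
  rw [← hx] at hq1 hq2
  rw [← hy] at hr1 hr2
  have e0 := hcon q r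
  have e1 := hcon (q + 1) r
  have e2 := hcon (q - 1) r
  have e3 := hcon q (r + 1)
  have e4 := hcon q (r - 1)
  rw [show a - n * (q + 1) = x - n by rw [hx]; ring, ← hy] at e1
  rw [show a - n * (q - 1) = x + n by rw [hx]; ring, ← hy] at e2
  rw [show b - n * (r + 1) = y - n by rw [hy]; ring, ← hx] at e3
  rw [show b - n * (r - 1) = y + n by rw [hy]; ring, ← hx] at e4
  rw [← hx, ← hy] at e0
  have hsymm (a b : ℤ) : eisNorm (-a) (-b) = eisNorm a b := by simp only [eisNorm]; ring
  rcases le_or_gt 0 x with hx0 | hx0 <;> rcases le_or_gt 0 y with hy0 | hy0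
  · simp only [eisNorm] at e0; nlinarith
  · exact key x (-y) hx0 (by lia) hq1 (by lia) (by simpa using e0) (by simpa using e1)
      (by simpa using e4)
  · refine key (-x) y (by lia) hy0 (by lia) hr1 ?_ ?_ ?_
    · rwa [hsymm]
    · rwa [show -x - n = -(x + n) by ring, hsymm]
    · rwa [show -y + n = -(y - n) by ring, hsymm]
  · simp only [eisNorm] at e0; nlinarith

open QuadraticAlgebra in
/-- If `X² + X + 1` has a root modulo the prime `π`, then `π` is up to a unit a norm from `A[ω]`,
provided that the latter is a principal ideal domain: `π` divides `(w - ω) (w + 1 + ω)` but neither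
factor, hence it is reducible in `A[ω]`. -/
theorem exists_associated_norm_of_prime {A : Type*} [CommRing A] [IsDomain A]
    [IsDomain (QuadraticAlgebra A (-1) (-1))] [IsPrincipalIdealRing (QuadraticAlgebra A (-1) (-1))]
    {π w : A} (hπ : Prime π) (hw : π ∣ w ^ 2 + w + 1) :
    ∃ z : QuadraticAlgebra A (-1) (-1), Associated (norm z) π := by
  have hnp : ¬ Prime (algebraMap A (QuadraticAlgebra A (-1) (-1)) π) := by
    intro hp
    have h1 : algebraMap A (QuadraticAlgebra A (-1) (-1)) π ∣ ⟨w, -1⟩ * ⟨w + 1, 1⟩ := by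
      have : (⟨w, -1⟩ * ⟨w + 1, 1⟩ : QuadraticAlgebra A (-1) (-1)) =
          algebraMap A _ (w ^ 2 + w + 1) := by
        ext
        · simp [-map_add, -map_pow, -map_mul]; ring
        · simp [-map_add, -map_pow, -map_mul]
      rw [this]
      exact map_dvd _ hw
    rcases hp.dvd_or_dvd h1 with h | h
    · have := (algebraMap_dvd_iff.1 h).2
      exact hπ.not_isUnit (isUnit_of_dvd_one (by simpa using this))
    · exact hπ.not_isUnit (isUnit_of_dvd_one (algebraMap_dvd_iff.1 h).2)
  have hu : ¬ IsUnit (algebraMap A (QuadraticAlgebra A (-1) (-1)) π) := by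
    rw [isUnit_iff_norm_isUnit, QuadraticAlgebra.norm_algebraMap]
    exact fun h => hπ.not_isUnit (isUnit_pow_iff two_ne_zero |>.1 h)
  rw [← irreducible_iff_prime, irreducible_iff] at hnp
  push Not at hnp
  obtain ⟨α, β, hαβ, hα, hβ⟩ := hnp hu
  have hN : norm α * norm β = π ^ 2 := by rw [← map_mul, ← hαβ, QuadraticAlgebra.norm_algebraMap]
  rw [isUnit_iff_norm_isUnit] at hα hβ
  obtain ⟨i, hi, hass⟩ := (dvd_prime_pow hπ 2).1 ⟨_, hN.symm⟩
  refine ⟨α, ?_⟩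
  interval_cases i
  · exact absurd (hass.symm.isUnit (by simp)) hα
  · simpa using hass
  · exfalso
    obtain ⟨u, hu⟩ := hass
    apply hβ
    have h0 : norm α ≠ 0 := by
      intro h; rw [h, zero_mul] at hu; exact pow_ne_zero 2 hπ.ne_zero hu.symm
    rw [← hu] at hN
    rw [mul_left_cancel₀ h0 hN]
    exact u.isUnit

/-- A prime `p ≡ 1 mod 3` has a primitive cube root of unity. -/
theorem exists_sq_add_self_add_one {p : ℕ} (hp : p.Prime) (h3 : p % 3 = 1) :
    ∃ w : ℤ, (p : ℤ) ∣ w ^ 2 + w + 1 := by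
  have := Fact.mk hp
  have hc : 3 ∣ Fintype.card (ZMod p)ˣ := by
    rw [ZMod.card_units p]; lia
  have := Fact.mk Nat.prime_three
  obtain ⟨x, hx⟩ := exists_prime_orderOf_dvd_card 3 hc
  have hx1 : (x : ZMod p) ≠ 1 := by
    intro h
    rw [Units.val_eq_one] at h
    rw [h, orderOf_one] at hx
    exact absurd hx (by norm_num)
  have hx3 : (x : ZMod p) ^ 3 = 1 := by
    rw [← Units.val_pow_eq_pow_val, ← hx, pow_orderOf_eq_one, Units.val_one]
  have h0 : (x : ZMod p) ^ 2 + x + 1 = 0 := by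
    have : ((x : ZMod p) - 1) * ((x : ZMod p) ^ 2 + x + 1) = 0 := by linear_combination hx3
    exact (mul_eq_zero.1 this).resolve_left (sub_ne_zero.2 hx1)
  refine ⟨((x : ZMod p).val : ℤ), ?_⟩
  rw [← ZMod.intCast_zmod_eq_zero_iff_dvd]
  push_cast
  rw [ZMod.natCast_zmod_val]
  exact h0

theorem eisNorm_nonneg (a b : ℤ) : 0 ≤ eisNorm a b := by
  simp only [eisNorm]; nlinarith [sq_nonneg (2 * a - b), sq_nonneg b]

theorem eisNorm_eq_zero {a b : ℤ} (h : eisNorm a b = 0) : a = 0 ∧ b = 0 := by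
  simp only [eisNorm] at h
  have hb : b = 0 := by nlinarith [sq_nonneg (2 * a - b), sq_nonneg b]
  subst hb
  simpa using h

/-- The ring `ℤ[ω]` of Eisenstein integers, with `ω² = -1 - ω`. -/
abbrev Eis := QuadraticAlgebra ℤ (-1) (-1)

theorem Eis.norm_eq (z : Eis) : z.norm = eisNorm z.re z.im := by
  rw [QuadraticAlgebra.norm_def, eisNorm]; ring

instance : IsDomain Eis :=
  have : NoZeroDivisors Eis := ⟨fun {a b} h => by
    have h0 := congrArg QuadraticAlgebra.norm h
    rw [map_mul, QuadraticAlgebra.norm_zero] at h0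
    have hz (z : Eis) (h : z.norm = 0) : z = 0 := by
      rw [Eis.norm_eq] at h
      exact QuadraticAlgebra.ext (eisNorm_eq_zero h).1 (eisNorm_eq_zero h).2
    exact (mul_eq_zero.1 h0).imp (hz a) (hz b)⟩
  NoZeroDivisors.to_isDomain _

/-- Division with remainder reduces to division by a positive integer, on multiplying dividend and
divisor by the cofactor `b'` of the divisor in its norm. -/
theorem exists_norm_sub_mul_lt {A : Type*} [CommRing A] (N : A →* ℤ) (k : ℕ)
    (hpos : ∀ a, a ≠ 0 → 0 < N a) (hint : ∀ n : ℤ, N n = n ^ k)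
    (hconj : ∀ a, ∃ b : A, a * b = (N a : A))
    (hdiv : ∀ (c : A) (n : ℤ), 0 < n → ∃ q, N (c - n * q) < n ^ k) (a b : A) (hb : b ≠ 0) :
    ∃ q, N (a - b * q) < N b := by
  obtain ⟨b', hb'⟩ := hconj b
  obtain ⟨q, hq⟩ := hdiv (a * b') (N b) (hpos b hb)
  refine ⟨q, ?_⟩
  have h1 : N (a - b * q) * N b' < N b * N b' := by
    rw [← map_mul, ← map_mul, hb', hint]
    convert hq using 2
    rw [← hb']; ring
  refine lt_of_mul_lt_mul_right h1 ?_
  have h2 : 0 < N b * N b' := by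
    rw [← map_mul, hb', hint]; exact pow_pos (hpos b hb) k
  exact (pos_of_mul_pos_right h2 (hpos b hb).le).le

instance : IsPrincipalIdealRing Eis := by
  refine isPrincipalIdealRing_of_forall_exists_lt (fun z => z.norm.natAbs) fun a b hb => ?_
  have hpos (z : Eis) (hz : z ≠ 0) : 0 < z.norm := by
    rw [Eis.norm_eq]
    refine lt_of_le_of_ne (eisNorm_nonneg _ _) fun h => hz ?_
    exact QuadraticAlgebra.ext (eisNorm_eq_zero h.symm).1 (eisNorm_eq_zero h.symm).2
  obtain ⟨q, hq⟩ := exists_norm_sub_mul_lt (QuadraticAlgebra.norm : Eis →* ℤ) 2 hpos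
    (fun n => by simp) (fun a => ⟨star a, by
      rw [← QuadraticAlgebra.algebraMap_norm_eq_mul_star]; rfl⟩)
    (fun c n hn => by
      obtain ⟨q, r, h⟩ := exists_two_mul_eisNorm_sub_lt hn c.re c.im
      refine ⟨⟨q, r⟩, ?_⟩
      rw [Eis.norm_eq]
      have := eisNorm_nonneg (c.re - n * q) (c.im - n * r)
      simp
      linarith) a b hb
  refine ⟨q, ?_⟩
  have := hpos b hb
  have h0 : 0 ≤ (a - b * q).norm := by rw [Eis.norm_eq]; exact eisNorm_nonneg _ _
  lia

theorem exists_eisNorm_eq {p : ℕ} (hp : p.Prime) (h3 : p % 3 = 1) :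
    ∃ a b : ℤ, eisNorm a b = p := by
  obtain ⟨w, hw⟩ := exists_sq_add_self_add_one hp h3
  obtain ⟨z, hz⟩ := exists_associated_norm_of_prime (Nat.prime_iff_prime_int.1 hp) hw
  refine ⟨z.re, z.im, ?_⟩
  rw [Eis.norm_eq, Int.associated_iff] at hz
  have := eisNorm_nonneg z.re z.im
  have := hp.pos
  lia

/-- The ring `ℤ[ω, i]`, the ring of integers of the twelfth cyclotomic field, as the quadratic
extension `ℤ[i][ω]` of the Gaussian integers. -/
abbrev EisGauss := QuadraticAlgebra GaussianInt (-1) (-1)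

namespace EisGauss

theorem norm_re (z : EisGauss) :
    z.norm.re = relNormRe z.re.re z.im.re z.re.im z.im.im := by
  rw [QuadraticAlgebra.norm_def, relNormRe, eisNorm, eisNorm]
  simp
  ring

theorem norm_im (z : EisGauss) :
    z.norm.im = relNormIm z.re.re z.im.re z.re.im z.im.im := by
  rw [QuadraticAlgebra.norm_def, relNormIm]
  simp
  ring

/-- The norm from `ℤ[ω, i]` to `ℤ`. -/
def absNorm : EisGauss →* ℤ := Zsqrtd.normMonoidHom.comp QuadraticAlgebra.norm

theorem absNorm_apply (z : EisGauss) : absNorm z = z.norm.norm := rfl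

/-- In particular the norm of `x + y i` with `x, y ∈ ℤ[ω]` is at most `(N x + N y)²`. -/
theorem absNorm_eq (z : EisGauss) : absNorm z =
    (eisNorm z.re.re z.im.re + eisNorm z.re.im z.im.im) ^ 2 -
      3 * (z.re.re * z.im.im - z.re.im * z.im.re) ^ 2 := by
  rw [absNorm_apply, Zsqrtd.norm_def, norm_re, norm_im]
  simp only [relNormRe, relNormIm, eisNorm]
  ring

theorem absNorm_pos {z : EisGauss} (hz : z ≠ 0) : 0 < absNorm z := by
  refine lt_of_le_of_ne (GaussianInt.norm_nonneg _) fun h => hz ?_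
  have h1 : z.norm = 0 := GaussianInt.norm_eq_zero.1 h.symm
  have hre := norm_re z
  rw [h1, Zsqrtd.re_zero, eq_comm, relNormRe, sub_eq_zero] at hre
  rw [absNorm_eq, ← hre] at h
  -- otherwise `√3` would be rational
  have hX : eisNorm z.re.re z.im.re = 0 := by
    by_contra hne
    have hirr := Nat.prime_three.irrational_sqrt
    have hk : (z.re.re * z.im.im - z.re.im * z.im.re : ℤ) ≠ 0 := by
      intro h0
      rw [h0] at h
      apply hne
      nlinarith
    apply hirr
    refine ⟨|((2 * eisNorm z.re.re z.im.re : ℤ) : ℚ) /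
      ((z.re.re * z.im.im - z.re.im * z.im.re : ℤ) : ℚ)|, ?_⟩
    have hk' : ((z.re.re * z.im.im - z.re.im * z.im.re : ℤ) : ℝ) ≠ 0 := by exact_mod_cast hk
    have h2 : (((2 * eisNorm z.re.re z.im.re : ℤ) : ℝ)) ^ 2 =
        3 * ((z.re.re * z.im.im - z.re.im * z.im.re : ℤ) : ℝ) ^ 2 := by
      have : (2 * eisNorm z.re.re z.im.re) ^ 2 =
        3 * (z.re.re * z.im.im - z.re.im * z.im.re) ^ 2 := by linarith
      exact_mod_cast this
    have h3 : ((3 : ℕ) : ℝ) = (((2 * eisNorm z.re.re z.im.re : ℤ) : ℝ) /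
        ((z.re.re * z.im.im - z.re.im * z.im.re : ℤ) : ℝ)) ^ 2 := by
      rw [div_pow, h2]; field_simp; norm_num
    rw [h3, Real.sqrt_sq_eq_abs, Rat.cast_abs, Rat.cast_div, Rat.cast_intCast, Rat.cast_intCast]
  obtain ⟨h2, h3⟩ := eisNorm_eq_zero hX
  obtain ⟨h4, h5⟩ := eisNorm_eq_zero (hre.symm.trans hX)
  exact QuadraticAlgebra.ext (Zsqrtd.ext h2 h4) (Zsqrtd.ext h3 h5)

instance : IsDomain EisGauss :=
  have : NoZeroDivisors EisGauss := ⟨fun {a b} h => by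
    by_contra! h0
    have h1 := mul_pos (absNorm_pos h0.1) (absNorm_pos h0.2)
    rw [← map_mul, h, absNorm_apply, QuadraticAlgebra.norm_zero] at h1
    simp at h1⟩
  NoZeroDivisors.to_isDomain _

instance : IsPrincipalIdealRing EisGauss := by
  refine isPrincipalIdealRing_of_forall_exists_lt (fun z => (absNorm z).natAbs) fun a b hb => ?_
  obtain ⟨q, hq⟩ := exists_norm_sub_mul_lt absNorm 4 (fun _ => absNorm_pos)
    (fun n => by
      rw [absNorm_apply, QuadraticAlgebra.norm_intCast, ← Int.cast_pow, Zsqrtd.norm_intCast]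
      ring)
    (fun a => ⟨star a * algebraMap _ _ (star a.norm), by
      rw [← mul_assoc, ← QuadraticAlgebra.algebraMap_norm_eq_mul_star, ← map_mul,
        ← Zsqrtd.norm_eq_mul_conj]; rfl⟩)
    (fun c n hn => by
      obtain ⟨q, r, h⟩ := exists_two_mul_eisNorm_sub_lt hn c.re.re c.im.re
      obtain ⟨s, t, h'⟩ := exists_two_mul_eisNorm_sub_lt hn c.re.im c.im.im
      refine ⟨⟨⟨q, s⟩, ⟨r, t⟩⟩, ?_⟩
      rw [absNorm_eq]
      have h1 := eisNorm_nonneg (c.re.re - n * q) (c.im.re - n * r)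
      have h2 := eisNorm_nonneg (c.re.im - n * s) (c.im.im - n * t)
      have h3 : (eisNorm (c.re.re - n * q) (c.im.re - n * r) +
          eisNorm (c.re.im - n * s) (c.im.im - n * t)) ^ 2 < (n ^ 2) ^ 2 :=
        pow_lt_pow_left₀ (by linarith) (by linarith) two_ne_zero
      simp
      nlinarith [sq_nonneg ((c.re.re - n * q) * (c.im.im - n * t) -
        (c.re.im - n * s) * (c.im.re - n * r))]) a b hb
  refine ⟨q, ?_⟩
  have := absNorm_pos hb
  have h0 : 0 ≤ absNorm (a - b * q) := GaussianInt.norm_nonneg _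
  lia

end EisGauss

theorem GaussianInt.isUnit_cases {u : GaussianInt} (hu : IsUnit u) :
    u = ⟨1, 0⟩ ∨ u = ⟨-1, 0⟩ ∨ u = ⟨0, 1⟩ ∨ u = ⟨0, -1⟩ := by
  rw [← Zsqrtd.norm_eq_one_iff] at hu
  obtain ⟨x, y⟩ := u
  have h : x ^ 2 + y ^ 2 = 1 := by
    have := GaussianInt.norm_nonneg ⟨x, y⟩
    rw [Zsqrtd.norm_def] at hu this
    simp only at hu this
    have h1 := Int.natAbs_of_nonneg this
    rw [hu] at h1
    push_cast at h1
    linarith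
  have hx : x ≤ 1 := by nlinarith [sq_nonneg y]
  have hx' : -1 ≤ x := by nlinarith [sq_nonneg y]
  have hy : y ≤ 1 := by nlinarith [sq_nonneg x]
  have hy' : -1 ≤ y := by nlinarith [sq_nonneg x]
  interval_cases x <;> interval_cases y <;> simp_all

theorem GaussianInt.prime_of_norm_prime {z : GaussianInt} {p : ℕ} (hp : p.Prime)
    (hz : z.norm = p) : Prime z := by
  rw [← irreducible_iff_prime, irreducible_iff]
  refine ⟨?_, fun a b hab => ?_⟩
  · rw [← Zsqrtd.norm_eq_one_iff, hz, Int.natAbs_natCast]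
    exact hp.ne_one
  · have h : a.norm.natAbs * b.norm.natAbs = p := by
      rw [← Int.natAbs_mul, ← Zsqrtd.norm_mul, ← hab, hz, Int.natAbs_natCast]
    rw [← Zsqrtd.norm_eq_one_iff, ← Zsqrtd.norm_eq_one_iff]
    have hirr := hp
    rw [← h, Nat.prime_mul_iff] at hirr
    tauto

theorem exists_eisGauss_norm_eq {p : ℕ} (hp : p.Prime) (h3 : p % 3 = 1) {c d : ℤ}
    (hcd : (p : ℤ) = c ^ 2 + d ^ 2) :
    ∃ z : EisGauss, ∃ u : GaussianInt, IsUnit u ∧ z.norm * u = ⟨c, d⟩ := by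
  obtain ⟨w, k, hw⟩ := exists_sq_add_self_add_one hp h3
  have hπ : Prime (⟨c, d⟩ : GaussianInt) := by
    apply GaussianInt.prime_of_norm_prime hp
    rw [Zsqrtd.norm_def, hcd]; ring
  obtain ⟨z, u, hu⟩ := exists_associated_norm_of_prime (w := (w : GaussianInt)) hπ
    ⟨⟨c, -d⟩ * (k : GaussianInt), by
      have h1 : (⟨c, d⟩ : GaussianInt) * ⟨c, -d⟩ = ((p : ℤ) : GaussianInt) := by
        ext
        · simp; linarith
        · simp; ring
      rw [← mul_assoc, h1, ← Int.cast_mul, ← hw]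
      push_cast
      ring⟩
  exact ⟨z, u, u.isUnit, hu⟩

/-! ### Attained values -/

theorem CharData.det_mem_groupDetValues (d : CharData) : d.det ∈ groupDetValues (Multiplicative (ZMod 12)) :=
  mem_groupDetValues_iff.2 ⟨d, rfl⟩

theorem mem_groupDetValues_of_isCoprime_six {m : ℤ} (hm : IsCoprime m 6) :
    m ∈ groupDetValues (Multiplicative (ZMod 12)) := by
  -- A multiple of the sum of all group elements changes the value at the trivial character by a
  -- multiple of `12`, and no other value.
  have h1 (k : ℤ) : 1 + 12 * k ∈ groupDetValues (Multiplicative (ZMod 12)) := by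
    convert CharData.det_mem_groupDetValues ⟨1 + 6 * k, 6 * k, 1, 0, 1, 0, 0, 0, 1, 0, 0, 0, by lia, by lia, by lia,
      by lia, by lia, by lia, by lia, by lia, by lia, by lia⟩ using 1
    simp only [CharData.det, CharData.eis, CharData.re, CharData.im, relNormRe, relNormIm, eisNorm]; ring
  have h5 (k : ℤ) : 5 + 12 * k ∈ groupDetValues (Multiplicative (ZMod 12)) := by
    convert CharData.det_mem_groupDetValues ⟨3 + 6 * k, 2 + 6 * k, 1, 0, 0, 0, 1, 1, 2, 2, -1, 1, by lia, by lia,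
      by lia, by lia, by lia, by lia, by lia, by lia, by lia, by lia⟩ using 1
    simp only [CharData.det, CharData.eis, CharData.re, CharData.im, relNormRe, relNormIm, eisNorm]; ring
  have h11 (k : ℤ) : -1 + 12 * k ∈ groupDetValues (Multiplicative (ZMod 12)) := by
    convert CharData.det_mem_groupDetValues ⟨6 * k, -1 + 6 * k, 0, -1, 0, 0, -1, 0, 0, 0, -1, 0, by lia, by lia,
      by lia, by lia, by lia, by lia, by lia, by lia, by lia, by lia⟩ using 1
    simp only [CharData.det, CharData.eis, CharData.re, CharData.im, relNormRe, relNormIm, eisNorm]; ring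
  have h2 : ¬ 2 ∣ m := fun h => by
    have := Int.isUnit_iff.1 (hm.isUnit_of_dvd' h (by norm_num)); lia
  have h3 : ¬ 3 ∣ m := fun h => by
    have := Int.isUnit_iff.1 (hm.isUnit_of_dvd' h (by norm_num)); lia
  obtain ⟨k, hk | hk | hk | hk⟩ : ∃ k, m = 1 + 12 * k ∨ m = 5 + 12 * k ∨ m = -1 + 12 * k ∨
      m = -1 * (5 + 12 * k) := by
    have : m % 12 = 1 ∨ m % 12 = 5 ∨ m % 12 = 7 ∨ m % 12 = 11 := by lia
    rcases this with h | h | h | h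
    · exact ⟨m / 12, by lia⟩
    · exact ⟨m / 12, by lia⟩
    · exact ⟨-(m / 12) - 1, by lia⟩
    · exact ⟨m / 12 + 1, by lia⟩
  · exact hk ▸ h1 k
  · exact hk ▸ h5 k
  · exact hk ▸ h11 k
  · exact hk ▸ mul_mem_groupDetValues (by simpa using h11 0) (h5 k)

theorem neg_mem_groupDetValues {n : ℤ} (hn : n ∈ groupDetValues (Multiplicative (ZMod 12))) :
    -n ∈ groupDetValues (Multiplicative (ZMod 12)) := by
  have := mul_mem_groupDetValues (mem_groupDetValues_of_isCoprime_six (isCoprime_one_left.neg_left)) hn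
  rwa [neg_one_mul] at this

theorem mul_144_mem_groupDetValues (m : ℤ) : 2 ^ 4 * 3 ^ 2 * m ∈ groupDetValues (Multiplicative (ZMod 12)) := by
  convert CharData.det_mem_groupDetValues ⟨1 + 6 * m, -1 + 6 * m, 1, 1, 1, 0, 0, -1, 1, 0, 0, 1, by lia, by lia,
    by lia, by lia, by lia, by lia, by lia, by lia, by lia, by lia⟩ using 1
  simp only [CharData.det, CharData.eis, CharData.re, CharData.im, relNormRe, relNormIm, eisNorm]; ring

theorem mul_64_mem_groupDetValues {m : ℤ} (hm : IsCoprime m 3) :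
    2 ^ 6 * m ∈ groupDetValues (Multiplicative (ZMod 12)) := by
  have h (k : ℤ) : 2 ^ 6 * (1 + 3 * k) ∈ groupDetValues (Multiplicative (ZMod 12)) := by
    convert CharData.det_mem_groupDetValues ⟨4 + 6 * k, 6 * k, 2, 0, 1, 0, 0, 0, -1, 0, 0, 0, by lia, by lia,
      by lia, by lia, by lia, by lia, by lia, by lia, by lia, by lia⟩ using 1
    simp only [CharData.det, CharData.eis, CharData.re, CharData.im, relNormRe, relNormIm, eisNorm]; ring
  have h3 : ¬ 3 ∣ m := fun h => by
    have := Int.isUnit_iff.1 (hm.isUnit_of_dvd' h (by norm_num)); lia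
  obtain ⟨k, rfl | rfl⟩ : ∃ k, m = 1 + 3 * k ∨ m = -(1 + 3 * k) := by
    have : m % 3 = 1 ∨ m % 3 = 2 := by lia
    rcases this with h | h
    · exact ⟨m / 3, by lia⟩
    · exact ⟨-(m / 3) - 1, by lia⟩
  · exact h k
  · rw [mul_neg]; exact neg_mem_groupDetValues (h k)

theorem mul_27_mem_groupDetValues {m : ℤ} (hm : IsCoprime m 2) :
    27 * m ∈ groupDetValues (Multiplicative (ZMod 12)) := by
  have h (k : ℤ) : -(27 * (1 + 4 * k)) ∈ groupDetValues (Multiplicative (ZMod 12)) := by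
    convert CharData.det_mem_groupDetValues ⟨1 + 6 * k, 2 + 6 * k, 1, 0, 1, 0, 2, 0, 1, 0, 0, 0, by lia, by lia,
      by lia, by lia, by lia, by lia, by lia, by lia, by lia, by lia⟩ using 1
    simp only [CharData.det, CharData.eis, CharData.re, CharData.im, relNormRe, relNormIm, eisNorm]; ring
  have h2 : ¬ 2 ∣ m := fun h => by
    have := Int.isUnit_iff.1 (hm.isUnit_of_dvd' h (by norm_num)); lia
  obtain ⟨k, rfl | rfl⟩ : ∃ k, m = 1 + 4 * k ∨ m = -(1 + 4 * k) := by
    have : m % 4 = 1 ∨ m % 4 = 3 := by lia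
    rcases this with h | h
    · exact ⟨m / 4, by lia⟩
    · exact ⟨-(m / 4) - 1, by lia⟩
  · rw [← neg_neg (27 * (1 + 4 * k))]; exact neg_mem_groupDetValues (h k)
  · rw [mul_neg]; exact h k

theorem mul_16_mem_groupDetValues {m : ℤ} (hm : IsCoprime m 6) :
    2 ^ 4 * m ∈ groupDetValues (Multiplicative (ZMod 12)) := by
  refine mul_mem_groupDetValues ?_ (mem_groupDetValues_of_isCoprime_six hm)
  convert CharData.det_mem_groupDetValues ⟨2, 0, 2, 0, -1, 0, 0, 0, -1, 0, 0, 0, by lia, by lia,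
    by lia, by lia, by lia, by lia, by lia, by lia, by lia, by lia⟩ using 1
  simp only [CharData.det, CharData.eis, CharData.re, CharData.im, relNormRe, relNormIm, eisNorm]; ring

theorem exists_sq_add_sq_of_mod_twelve_eq_five {p : ℕ} (hp : p.Prime) (h : p % 12 = 5) :
    ∃ a b : ℤ, (p : ℤ) = a ^ 2 + b ^ 2 ∧ 2 ∣ b ∧ 3 ∣ a - 1 ∧ 3 ∣ b - 1 := by
  have := Fact.mk hp
  obtain ⟨a, b, hab⟩ := Nat.Prime.sq_add_sq (p := p) (by lia)
  have hsign (c : ℤ) (hc : ¬ 3 ∣ c) : ∃ c', c' ^ 2 = c ^ 2 ∧ 3 ∣ c' - 1 := by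
    by_cases h1 : 3 ∣ c - 1
    · exact ⟨c, rfl, h1⟩
    · exact ⟨-c, neg_sq c, by lia⟩
  have hmod : (a : ℤ) % 3 ≠ 0 ∧ (b : ℤ) % 3 ≠ 0 := by
    have h3 : ((a : ℤ) ^ 2 + (b : ℤ) ^ 2) % 3 = 2 := by
      have : (a : ℤ) ^ 2 + (b : ℤ) ^ 2 = p := by exact_mod_cast hab
      lia
    have ha : (a : ℤ) % 3 = 0 ∨ (a : ℤ) % 3 = 1 ∨ (a : ℤ) % 3 = 2 := by lia
    have hb : (b : ℤ) % 3 = 0 ∨ (b : ℤ) % 3 = 1 ∨ (b : ℤ) % 3 = 2 := by lia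
    rcases ha with ha | ha | ha <;> rcases hb with hb | hb | hb <;>
      simp [pow_two, Int.add_emod, Int.mul_emod, ha, hb] at h3 ⊢
  obtain ⟨c, hc, hc3⟩ := hsign a (by lia)
  obtain ⟨d, hd, hd3⟩ := hsign b (by lia)
  have hpcd : (p : ℤ) = c ^ 2 + d ^ 2 := by rw [hc, hd]; exact_mod_cast hab.symm
  rcases Int.even_or_odd d with he | ho
  · exact ⟨c, d, hpcd, he.two_dvd, hc3, hd3⟩
  · refine ⟨d, c, by rw [hpcd]; ring, ?_, hd3, hc3⟩
    by_contra hce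
    have hco : Odd c := Int.not_even_iff_odd.1 fun h => hce h.two_dvd
    have := hco.pow (n := 2) |>.add_odd (ho.pow (n := 2))
    rw [← hpcd] at this
    obtain ⟨r, hr⟩ := this
    lia

/-- The element of norm `p` can be taken to be `√-3 + 4 β`, where `√-3 = 1 + 2 ω` and
`β = b₀ + b₁ ω ≡ -1` modulo `√-3`. -/
theorem exists_eisNorm_eq_of_mod_twelve_eq_seven {p : ℕ} (hp : p.Prime) (h : p % 12 = 7) :
    ∃ b₀ b₁ : ℤ, 3 ∣ b₀ + b₁ + 1 ∧ eisNorm (1 + 4 * b₀) (2 + 4 * b₁) = p := by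
  obtain ⟨a, b, hab⟩ := exists_eisNorm_eq hp (by lia)
  obtain ⟨x, y, hxy⟩ : ∃ x y : ℤ, x ^ 2 + 3 * y ^ 2 = p := by
    simp only [eisNorm] at hab
    rcases Int.even_or_odd' b with ⟨k, rfl | hb⟩
    · exact ⟨a - k, k, by rw [← hab]; ring⟩
    · rcases Int.even_or_odd' a with ⟨l, rfl | ha⟩
      · exact ⟨b - l, l, by rw [← hab]; ring⟩
      · exact ⟨b + (l - k), l - k, by rw [← hab, ha, hb]; ring⟩
  have hx4 : x % 2 = 0 ∧ y % 2 = 1 := by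
    have h4 : (x ^ 2 + 3 * y ^ 2) % 4 = 3 := by lia
    have hx : x % 4 = 0 ∨ x % 4 = 1 ∨ x % 4 = 2 ∨ x % 4 = 3 := by lia
    have hy : y % 4 = 0 ∨ y % 4 = 1 ∨ y % 4 = 2 ∨ y % 4 = 3 := by lia
    rcases hx with hx | hx | hx | hx <;> rcases hy with hy | hy | hy | hy <;>
      simp [pow_two, Int.add_emod, Int.mul_emod, hx, hy] at h4 <;> lia
  have hx3 : x % 3 ≠ 0 := by
    intro h0
    have : (x ^ 2 + 3 * y ^ 2) % 3 = 0 := by simp [pow_two, Int.add_emod, Int.mul_emod, h0]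
    lia
  -- The signs of `x` and `y` make `x + y √-3` congruent to `-1` modulo `√-3` and to `√-3` modulo `4`.
  obtain ⟨x', hx', hx'3⟩ : ∃ x', x' ^ 2 = x ^ 2 ∧ (x' % 2 = 0 ∧ x' % 3 = 2) := by
    rcases (by lia : x % 3 = 2 ∨ x % 3 = 1) with h | h
    · exact ⟨x, rfl, hx4.1, h⟩
    · exact ⟨-x, neg_sq x, by lia⟩
  obtain ⟨y', hy', hy'4⟩ : ∃ y', y' ^ 2 = y ^ 2 ∧ (x' + y') % 4 = 1 := by
    rcases (by lia : (x' + y) % 4 = 1 ∨ (x' + -y) % 4 = 1) with h | h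
    · exact ⟨y, rfl, h⟩
    · exact ⟨-y, neg_sq y, h⟩
  obtain ⟨b₀, hb₀⟩ : 4 ∣ x' + y' - 1 := by lia
  obtain ⟨b₁, hb₁⟩ : 2 ∣ y' - 1 := by lia
  refine ⟨b₀, b₁, by lia, ?_⟩
  rw [← hxy, ← hx', ← hy', ← hb₀, show 2 + 4 * b₁ = 2 * y' by lia, eisNorm]
  ring

/-- If the relative norm of `a + b i` is congruent to `i` modulo `2`, then `a` and `b` are distinct
and nonzero in `ℤ[ω] / 2`; the three alternatives are `a = 1`, `a = ω` and `a = 1 + ω`. -/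
theorem relNorm_parity {a₀ a₁ b₀ b₁ : ℤ} (hre : relNormRe a₀ a₁ b₀ b₁ % 2 = 0)
    (him : relNormIm a₀ a₁ b₀ b₁ % 2 = 1) :
    (a₀ % 2 = 1 ∧ a₁ % 2 = 0 ∧ b₁ % 2 = 1) ∨ (a₀ % 2 = 0 ∧ a₁ % 2 = 1 ∧ b₀ % 2 = 1) ∨
      (a₀ % 2 = 1 ∧ a₁ % 2 = 1 ∧ (b₀ + b₁) % 2 = 1) := by
  simp only [relNormRe, relNormIm, eisNorm] at hre him
  rcases Int.emod_two_eq_zero_or_one a₀ with h1 | h1 <;>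
    rcases Int.emod_two_eq_zero_or_one a₁ with h2 | h2 <;>
    rcases Int.emod_two_eq_zero_or_one b₀ with h3 | h3 <;>
    rcases Int.emod_two_eq_zero_or_one b₁ with h4 | h4 <;>
    simp [pow_two, Int.add_emod, Int.sub_emod, Int.mul_emod, h1, h2, h3, h4] at hre him ⊢

/-- For `p ∈ primesP1` there is `a + b i ∈ ℤ[ω, i]` of norm `p` with `a ≡ 1` and `b ≡ ω` modulo `2`,
and `a ≡ 1` and `b ≡ 0` modulo `√-3`. -/
theorem exists_relNorm_normalized {p : ℕ} (hp : p ∈ primesP1) :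
    ∃ a₀ a₁ b₀ b₁ : ℤ, relNormRe a₀ a₁ b₀ b₁ ^ 2 + relNormIm a₀ a₁ b₀ b₁ ^ 2 = p ∧
      a₀ % 2 = 1 ∧ a₁ % 2 = 0 ∧ b₀ % 2 = 0 ∧ b₁ % 2 = 1 ∧ (a₀ + a₁) % 3 = 1 ∧
      (b₀ + b₁) % 3 = 0 := by
  obtain ⟨hprime, hmod, k, t, hkt⟩ := hp
  have hmod' : p % 12 = 1 := hmod
  -- Up to units, the relative norm `r + s i` is congruent to `2 + 3 i` modulo `6`.
  let Q (r s : ℤ) : Prop := (r % 2 = 0 ∧ r % 3 ≠ 0 ∧ s % 2 = 1 ∧ s % 3 = 0) ∨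
    (s % 2 = 0 ∧ s % 3 ≠ 0 ∧ r % 2 = 1 ∧ r % 3 = 0)
  have h0 : ∃ a₀ a₁ b₀ b₁ : ℤ, relNormRe a₀ a₁ b₀ b₁ ^ 2 + relNormIm a₀ a₁ b₀ b₁ ^ 2 = p ∧
      Q (relNormRe a₀ a₁ b₀ b₁) (relNormIm a₀ a₁ b₀ b₁) := by
    obtain ⟨z, u, hu, hz⟩ := exists_eisGauss_norm_eq hprime (by lia) hkt
    refine ⟨z.re.re, z.im.re, z.re.im, z.im.im, ?_⟩
    have hre : z.norm.re = relNormRe z.re.re z.im.re z.re.im z.im.im := EisGauss.norm_re z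
    have him : z.norm.im = relNormIm z.re.re z.im.re z.re.im z.im.im := EisGauss.norm_im z
    rw [← hre, ← him, hkt]
    generalize z.norm = c at hz
    obtain ⟨r, s⟩ := c
    simp only [Q]
    rcases GaussianInt.isUnit_cases hu with rfl | rfl | rfl | rfl <;>
      simp [Zsqrtd.ext_iff] at hz ⊢ <;> obtain ⟨h1, h2⟩ := hz <;>
      refine ⟨by rw [← h1, ← h2] <;> ring, by lia⟩
  have h1 : ∃ a₀ a₁ b₀ b₁ : ℤ, relNormRe a₀ a₁ b₀ b₁ ^ 2 + relNormIm a₀ a₁ b₀ b₁ ^ 2 = p ∧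
      Q (relNormRe a₀ a₁ b₀ b₁) (relNormIm a₀ a₁ b₀ b₁) ∧
      ((a₀ + a₁) % 3 = 0 ∨ (b₀ + b₁) % 3 = 0) := by
    obtain ⟨a₀, a₁, b₀, b₁, hN, hQ⟩ := h0
    by_cases hd : (a₀ + a₁) % 3 = 0 ∨ (b₀ + b₁) % 3 = 0
    · exact ⟨a₀, a₁, b₀, b₁, hN, hQ, hd⟩
    · -- multiplication by the unit `1 + i ω`, whose relative norm is `-i`
      have hre : relNormRe (a₀ + b₁) (a₁ - b₀ + b₁) (b₀ - a₁) (b₁ + a₀ - a₁) =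
          relNormIm a₀ a₁ b₀ b₁ := by simp only [relNormRe, relNormIm, eisNorm]; ring
      have him : relNormIm (a₀ + b₁) (a₁ - b₀ + b₁) (b₀ - a₁) (b₁ + a₀ - a₁) =
          -relNormRe a₀ a₁ b₀ b₁ := by simp only [relNormRe, relNormIm, eisNorm]; ring
      refine ⟨a₀ + b₁, a₁ - b₀ + b₁, b₀ - a₁, b₁ + a₀ - a₁, ?_, ?_, by lia⟩
      · rw [hre, him, ← hN]; ring
      · rw [hre, him]; simp only [Q] at hQ ⊢; lia
  -- multiplication by `i`
  have h2 : ∃ a₀ a₁ b₀ b₁ : ℤ, relNormRe a₀ a₁ b₀ b₁ ^ 2 + relNormIm a₀ a₁ b₀ b₁ ^ 2 = p ∧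
      Q (relNormRe a₀ a₁ b₀ b₁) (relNormIm a₀ a₁ b₀ b₁) ∧ (b₀ + b₁) % 3 = 0 := by
    obtain ⟨a₀, a₁, b₀, b₁, hN, hQ, hd | hd⟩ := h1
    · have hre : relNormRe (-b₀) (-b₁) a₀ a₁ = -relNormRe a₀ a₁ b₀ b₁ := by
        simp only [relNormRe, eisNorm]; ring
      have him : relNormIm (-b₀) (-b₁) a₀ a₁ = -relNormIm a₀ a₁ b₀ b₁ := by
        simp only [relNormIm]; ring
      refine ⟨-b₀, -b₁, a₀, a₁, ?_, ?_, hd⟩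
      · rw [hre, him, ← hN]; ring
      · rw [hre, him]; simp only [Q] at hQ ⊢; lia
    · exact ⟨a₀, a₁, b₀, b₁, hN, hQ, hd⟩
  -- Now the relative norm is `1` modulo `3`, so its real part is the even one; the sign makes `a ≡ 1`
  -- modulo `√-3`.
  have h3 : ∃ a₀ a₁ b₀ b₁ : ℤ, relNormRe a₀ a₁ b₀ b₁ ^ 2 + relNormIm a₀ a₁ b₀ b₁ ^ 2 = p ∧
      relNormRe a₀ a₁ b₀ b₁ % 2 = 0 ∧ relNormIm a₀ a₁ b₀ b₁ % 2 = 1 ∧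
      (a₀ + a₁) % 3 = 1 ∧ (b₀ + b₁) % 3 = 0 := by
    obtain ⟨a₀, a₁, b₀, b₁, hN, hQ, hb⟩ := h2
    have him : relNormIm a₀ a₁ b₀ b₁ % 3 = 0 := by
      obtain ⟨c, hc⟩ : 3 ∣ b₀ + b₁ := Int.dvd_of_emod_eq_zero hb
      have : relNormIm a₀ a₁ b₀ b₁ = 3 * (2 * a₀ * c - a₀ * b₁ - a₁ * c + a₁ * b₁) := by
        rw [relNormIm]; linear_combination (2 * a₀ - a₁) * hc
      lia
    have hr : relNormRe a₀ a₁ b₀ b₁ % 2 = 0 ∧ relNormIm a₀ a₁ b₀ b₁ % 2 = 1 ∧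
        relNormRe a₀ a₁ b₀ b₁ % 3 ≠ 0 := by
      simp only [Q] at hQ; lia
    have ha : (a₀ + a₁) % 3 ≠ 0 := by
      intro ha
      obtain ⟨c, hc⟩ : 3 ∣ b₀ + b₁ := Int.dvd_of_emod_eq_zero hb
      obtain ⟨d, hd⟩ : 3 ∣ a₀ + a₁ := Int.dvd_of_emod_eq_zero ha
      have : relNormRe a₀ a₁ b₀ b₁ =
          3 * (d * (a₀ + a₁) - a₀ * a₁ - c * (b₀ + b₁) + b₀ * b₁) := by
        rw [relNormRe, eisNorm, eisNorm]
        linear_combination (a₀ + a₁) * hd - (b₀ + b₁) * hc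
      lia
    rcases (by lia : (a₀ + a₁) % 3 = 1 ∨ (a₀ + a₁) % 3 = 2) with h | h
    · exact ⟨a₀, a₁, b₀, b₁, hN, hr.1, hr.2.1, h, hb⟩
    · have hre' : relNormRe (-a₀) (-a₁) (-b₀) (-b₁) = relNormRe a₀ a₁ b₀ b₁ := by
        simp only [relNormRe, eisNorm]; ring
      have him' : relNormIm (-a₀) (-a₁) (-b₀) (-b₁) = relNormIm a₀ a₁ b₀ b₁ := by
        simp only [relNormIm]; ring
      exact ⟨-a₀, -a₁, -b₀, -b₁, by rw [hre', him', hN], by rw [hre']; exact hr.1,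
        by rw [him']; exact hr.2.1, by lia, by lia⟩
  -- multiplication by a power of `ω`
  have h4 : ∃ a₀ a₁ b₀ b₁ : ℤ, relNormRe a₀ a₁ b₀ b₁ ^ 2 + relNormIm a₀ a₁ b₀ b₁ ^ 2 = p ∧
      a₀ % 2 = 1 ∧ a₁ % 2 = 0 ∧ b₁ % 2 = 1 ∧ (a₀ + a₁) % 3 = 1 ∧ (b₀ + b₁) % 3 = 0 := by
    obtain ⟨a₀, a₁, b₀, b₁, hN, hre, him, ha, hb⟩ := h3
    rcases relNorm_parity hre him with h | h | h
    · exact ⟨a₀, a₁, b₀, b₁, hN, by lia⟩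
    · refine ⟨a₁ - a₀, -a₀, b₁ - b₀, -b₀, ?_, by lia⟩
      rw [← hN]; simp only [relNormRe, relNormIm, eisNorm]; ring
    · refine ⟨-a₁, a₀ - a₁, -b₁, b₀ - b₁, ?_, by lia⟩
      rw [← hN]; simp only [relNormRe, relNormIm, eisNorm]; ring
  obtain ⟨a₀, a₁, b₀, b₁, hN, h⟩ := h4
  rcases Int.emod_two_eq_zero_or_one b₀ with hb₀ | hb₀
  · exact ⟨a₀, a₁, b₀, b₁, hN, by lia⟩
  · -- here `b ≡ 1 + ω` modulo `2`, and the conjugation of `ω` takes `b` to `ω`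
    refine ⟨a₀ - a₁, -a₁, b₀ - b₁, -b₁, ?_, by lia⟩
    rw [← hN]; simp only [relNormRe, relNormIm, eisNorm]; ring

/-- For `p ≡ 5 mod 12` the prime occurs in the value at a character of order `4`, for `p ≡ 7 mod 12`
at a character of order `6`, and for `p ∈ primesP1` at a character of order `12`. -/
theorem neg_nine_mul_mem_groupDetValues {p : ℕ} (hp : p ∈ admissiblePrimes) :
    -(9 * (p : ℤ)) ∈ groupDetValues (Multiplicative (ZMod 12)) := by
  obtain ⟨hprime, h | h | h⟩ := hp
  · obtain ⟨a, b, hab, hb2, ha3, hb3⟩ := exists_sq_add_sq_of_mod_twelve_eq_five hprime h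
    have ha2 : 2 ∣ 1 - a := by
      by_contra hc
      have h2 : 2 ∣ a ^ 2 + b ^ 2 :=
        dvd_add (dvd_pow (by lia) two_ne_zero) (dvd_pow hb2 two_ne_zero)
      have : p % 12 = 5 := h
      lia
    convert CharData.det_mem_groupDetValues ⟨1, 2, a, b, 1, 0, 0, -1, 1, 0, 0, 1, by lia, by lia,
      by lia, by lia, by lia, by lia, by lia, by lia, by lia, by lia⟩ using 1
    rw [hab]
    simp only [CharData.det, CharData.eis, CharData.re, CharData.im, relNormRe, relNormIm, eisNorm]; ring
  · obtain ⟨b₀, b₁, hb, hN⟩ := exists_eisNorm_eq_of_mod_twelve_eq_seven hprime h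
    convert CharData.det_mem_groupDetValues ⟨1, 2, 1, 0, 1 + 2 * b₀, 2 + 2 * b₁, -2 * b₀, -2 * b₁, 1, 0, 0, 0,
      by lia, by lia, by lia, by lia, by lia, by lia, by lia, by lia, by lia, by lia⟩ using 1
    rw [← hN]
    simp only [CharData.det, CharData.eis, CharData.re, CharData.im, relNormRe, relNormIm, eisNorm]; ring
  · obtain ⟨a₀, a₁, b₀, b₁, hN, h1, h2, h3, h4, h5, h6⟩ := exists_relNorm_normalized h
    convert CharData.det_mem_groupDetValues ⟨1, 2, 1, 0, 1, 0, 0, -1, a₀, a₁, b₀, b₁,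
      by lia, by lia, by lia, by lia, by lia, by lia, by lia, by lia, by lia, by lia⟩ using 1
    rw [← hN]
    simp only [CharData.det, CharData.eis, CharData.re, CharData.im, relNormRe, relNormIm, eisNorm]
    ring

/-- The prime occurs at characters of order `4`, `3` and `12`, respectively. -/
theorem thirty_two_mul_mem_groupDetValues {p : ℕ} (hp : p ∈ admissiblePrimes) :
    2 ^ 5 * (p : ℤ) ∈ groupDetValues (Multiplicative (ZMod 12)) := by
  obtain ⟨hprime, h | h | h⟩ := hp
  · obtain ⟨a, b, hab, hb2, ha3, hb3⟩ := exists_sq_add_sq_of_mod_twelve_eq_five hprime h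
    convert CharData.det_mem_groupDetValues ⟨2, 0, 2 * (a + b), 2 * (a - b), -1, 0, 0, 0, 1, 0, 0, 0, by lia,
      by lia, by lia, by lia, by lia, by lia, by lia, by lia, by lia, by lia⟩ using 1
    rw [hab]
    simp only [CharData.det, CharData.eis, CharData.re, CharData.im, relNormRe, relNormIm, eisNorm]; ring
  · -- the value `(√-3 + 4 β) ω²` at a character of order `3`
    obtain ⟨b₀, b₁, hb, hN⟩ := exists_eisNorm_eq_of_mod_twelve_eq_seven hprime h
    convert CharData.det_mem_groupDetValues ⟨2, 0, -2, -2, 1 + 2 * (b₁ - b₀), -2 * b₀, 2 * (b₁ - b₀),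
      -1 - 2 * b₀, 1, 0, 0, 1,
      by lia, by lia, by lia, by lia, by lia, by lia, by lia, by lia, by lia, by lia⟩ using 1
    rw [← hN]
    simp only [CharData.det, CharData.eis, CharData.re, CharData.im, relNormRe, relNormIm, eisNorm]; ring
  · -- the value `ω² (1 + i ω) (a + b i)`, congruent to `1` modulo `2`, at a character of order `12`
    obtain ⟨a₀, a₁, b₀, b₁, hN, h1, h2, h3, h4, h5, h6⟩ := exists_relNorm_normalized h
    convert CharData.det_mem_groupDetValues ⟨2, 0, -2, -2, -1, 0, 0, 0, a₁ - a₀ - b₀, -a₀ - b₁, b₁ - b₀ + a₀,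
      -b₀ + a₁,
      by lia, by lia, by lia, by lia, by lia, by lia, by lia, by lia, by lia, by lia⟩ using 1
    rw [← hN]
    simp only [CharData.det, CharData.eis, CharData.re, CharData.im, relNormRe, relNormIm, eisNorm]
    ring

/-! ### Norms without admissible prime factors -/

theorem eisNorm_mul (a b c d : ℤ) :
    eisNorm a b * eisNorm c d = eisNorm (a * c - b * d) (a * d + b * c - b * d) := by
  simp only [eisNorm]; ring

/-- Division by `√-3`, up to a unit. -/
theorem exists_eisNorm_eq_of_three_mul {a b k : ℤ} (h : eisNorm a b = 3 * k) :
    ∃ c d : ℤ, eisNorm c d = k := by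
  have h3 : (3 : ℤ) ∣ (a + b) ^ 2 := ⟨k + a * b, by rw [eisNorm] at h; linear_combination h⟩
  obtain ⟨c, hc⟩ := Int.prime_three.dvd_of_dvd_pow h3
  obtain rfl : a = 3 * c - b := by linarith
  refine ⟨b - c, c, ?_⟩
  simp only [eisNorm] at h ⊢
  linarith

/-- Primes `q ≡ 2 mod 3` are inert in `ℤ[ω]`. -/
theorem dvd_of_dvd_eisNorm {q : ℕ} (hq : q.Prime) (h3 : q % 3 = 2) {a b : ℤ}
    (h : (q : ℤ) ∣ eisNorm a b) : (q : ℤ) ∣ a ∧ (q : ℤ) ∣ b := by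
  have := Fact.mk hq
  have hb : (q : ℤ) ∣ b := by
    by_contra hb
    rw [← ZMod.intCast_zmod_eq_zero_iff_dvd] at hb h
    rw [eisNorm] at h
    push_cast at h
    obtain ⟨y, hy⟩ : ∃ y : ZMod q, y = -(a / b) := ⟨_, rfl⟩
    have hy1 : y ^ 2 + y + 1 = 0 := by
      have ha : (a : ZMod q) = -y * b := by rw [hy]; field_simp
      rw [ha] at h
      have : (b : ZMod q) ^ 2 * (y ^ 2 + y + 1) = 0 := by linear_combination h
      exact (mul_eq_zero.1 this).resolve_left (pow_ne_zero 2 hb)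
    have hy3 : y ^ 3 = 1 := by linear_combination (y - 1) * hy1
    have hy0 : y ≠ 0 := by rintro rfl; simp at hy3
    -- the order of `y` divides both `3` and `q - 1`, which are coprime
    have hfer := ZMod.pow_card_sub_one_eq_one hy0
    obtain ⟨m, hm⟩ : ∃ m, q - 1 = 3 * m + 1 := ⟨q / 3, by lia⟩
    rw [hm, pow_add, pow_mul, hy3, one_pow, one_mul, pow_one] at hfer
    rw [hfer] at hy1
    have h30 : ((3 : ℕ) : ZMod q) = 0 := by push_cast; linear_combination hy1
    rw [ZMod.natCast_eq_zero_iff] at h30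
    have := (Nat.prime_dvd_prime_iff_eq hq Nat.prime_three).1 h30
    lia
  refine ⟨?_, hb⟩
  refine (Nat.prime_iff_prime_int.1 hq).dvd_of_dvd_pow (n := 2) ?_
  have : a ^ 2 = eisNorm a b + b * (a - b) := by rw [eisNorm]; ring
  rw [this]
  exact dvd_add h (hb.mul_right _)

theorem mod_four_eq_one_of_prime_factors {n : ℕ} (hn : n ≠ 0)
    (h : ∀ q : ℕ, q.Prime → q ∣ n → q % 4 = 1) : n % 4 = 1 := by
  induction n using Nat.strong_induction_on with
  | _ n ih =>
    by_cases h1 : n = 1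
    · rw [h1]
    · obtain ⟨q, hq, m, rfl⟩ := Nat.exists_prime_and_dvd h1
      have hm : m ≠ 0 := right_ne_zero_of_mul hn
      have h2 := ih m (by nlinarith [hq.two_le, Nat.pos_of_ne_zero hm]) hm
        fun r hr hrm => h r hr (hrm.mul_left q)
      rw [Nat.mul_mod, h q hq (dvd_mul_right q m), h2]

theorem eisNorm_mod_four {n : ℕ} {a b : ℤ} (hn : eisNorm a b = n) (h2 : n % 2 = 1)
    (h3 : n % 3 ≠ 0) (h : ∀ q : ℕ, q.Prime → q ∣ n → q % 12 ≠ 7) : n % 4 = 1 := by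
  induction n using Nat.strong_induction_on generalizing a b with
  | _ n ih =>
    by_cases hq : ∃ q : ℕ, q.Prime ∧ q ∣ n ∧ q % 3 = 2
    · obtain ⟨q, hq, hqn, hq3⟩ := hq
      obtain ⟨⟨c, rfl⟩, d, rfl⟩ := dvd_of_dvd_eisNorm hq hq3 (hn ▸ Int.natCast_dvd_natCast.2 hqn)
      have hcd : (n : ℤ) = q ^ 2 * eisNorm c d := by
        rw [← hn]; simp only [eisNorm]; ring
      have h0 := eisNorm_nonneg c d
      obtain ⟨m, hm⟩ := Int.eq_ofNat_of_zero_le h0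
      have hnm : n = q ^ 2 * m := by rw [hm] at hcd; exact_mod_cast hcd
      have hm0 : 0 < m := by
        rcases Nat.eq_zero_or_pos m with h | h
        · rw [h] at hnm; lia
        · exact h
      have hqo : q % 2 = 1 := by
        rcases hq.eq_two_or_odd with h | h
        · rw [h] at hqn; lia
        · exact h
      have hq4 : q ^ 2 % 4 = 1 := by
        rcases (by lia : q % 4 = 1 ∨ q % 4 = 3) with h | h <;> simp [Nat.pow_mod, h]
      have hmn : m % 4 = n % 4 := by rw [hnm, Nat.mul_mod, hq4]; lia
      have := ih m (by nlinarith [Nat.pow_le_pow_left hq.two_le 2]) hm (by lia)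
        (fun h => h3 (by rw [hnm, Nat.mul_mod, h, mul_zero, Nat.zero_mod]))
        fun r hr hrm => h r hr (hnm ▸ hrm.mul_left _)
      lia
    · push Not at hq
      refine mod_four_eq_one_of_prime_factors (by lia) fun q hqp hqn => ?_
      have h7 := h q hqp hqn
      have hq3 := hq q hqp hqn
      have hq2 : q % 2 ≠ 0 := fun h' => by
        have := (Nat.dvd_of_mod_eq_zero h').trans hqn; lia
      have hq0 : q % 3 ≠ 0 := fun h' => by
        have := (Nat.dvd_of_mod_eq_zero h').trans hqn; lia
      lia

/-- A Gaussian integer whose norm is a prime other than `2` and `3` that is not admissible is congruent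
to a unit modulo `6`; since the norm is coprime to `6`, this amounts to a coordinate divisible by
`6`. -/
theorem six_dvd_or_of_sq_add_sq_prime {p : ℕ} (hp : p.Prime) (h2 : p ≠ 2) (h3 : p ≠ 3)
    (hadm : p ∉ admissiblePrimes) {a b : ℤ} (hab : (p : ℤ) = a ^ 2 + b ^ 2) : 6 ∣ a ∨ 6 ∣ b := by
  have hp2 : p % 2 = 1 := hp.eq_two_or_odd.resolve_left h2
  have hp3 : p % 3 ≠ 0 := fun h =>
    h3 ((Nat.prime_dvd_prime_iff_eq Nat.prime_three hp).1 (Nat.dvd_of_mod_eq_zero h)).symm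
  have h57 : p % 12 ≠ 5 ∧ p % 12 ≠ 7 ∧ p ∉ primesP1 := by
    refine ⟨fun h => hadm ⟨hp, Or.inl h⟩, fun h => hadm ⟨hp, Or.inr (Or.inl h)⟩,
      fun h => hadm ⟨hp, Or.inr (Or.inr h)⟩⟩
  have h4 : (a ^ 2 + b ^ 2) % 4 = 1 ∧ (a % 2 = 0 ∨ b % 2 = 0) := by
    have ho : (a ^ 2 + b ^ 2) % 2 = 1 := by lia
    have hx : a % 4 = 0 ∨ a % 4 = 1 ∨ a % 4 = 2 ∨ a % 4 = 3 := by lia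
    have hy : b % 4 = 0 ∨ b % 4 = 1 ∨ b % 4 = 2 ∨ b % 4 = 3 := by lia
    have hx' : a % 4 % 2 = a % 2 := by lia
    have hy' : b % 4 % 2 = b % 2 := by lia
    rcases hx with hx | hx | hx | hx <;> rcases hy with hy | hy | hy | hy <;>
      rw [hx] at hx' <;> rw [hy] at hy' <;>
      simp [pow_two, Int.add_emod, Int.mul_emod, hx, hy, ← hx', ← hy'] at ho ⊢
  have hp12 : p % 12 = 1 := by lia
  have hm3 : a % 3 = 0 ∨ b % 3 = 0 := by
    have ho : (a ^ 2 + b ^ 2) % 3 = 1 := by lia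
    have hx : a % 3 = 0 ∨ a % 3 = 1 ∨ a % 3 = 2 := by lia
    have hy : b % 3 = 0 ∨ b % 3 = 1 ∨ b % 3 = 2 := by lia
    rcases hx with hx | hx | hx <;> rcases hy with hy | hy | hy <;>
      simp [pow_two, Int.add_emod, Int.mul_emod, hx, hy] at ho ⊢
  -- otherwise, up to order and sign, the coordinates exhibit `p` as an element of `primesP1`
  have key (c d : ℤ) (hcd : (p : ℤ) = c ^ 2 + d ^ 2) (hc : c % 6 = 2 ∨ c % 6 = 4)
      (hd : d % 6 = 3) : False := by
    rcases hc with hc | hc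
    · exact h57.2.2 ⟨hp, hp12, c / 6, d / 6, by
        rw [show 6 * (c / 6) + 2 = c by lia, show 6 * (d / 6) + 3 = d by lia, hcd]⟩
    · exact h57.2.2 ⟨hp, hp12, -(c / 6) - 1, d / 6, by
        rw [show 6 * (-(c / 6) - 1) + 2 = -c by lia, show 6 * (d / 6) + 3 = d by lia, hcd]
        ring⟩
  by_contra! hcon
  have hk1 := key a b hab
  have hk2 := key b a (by rw [hab]; ring)
  have hnot : ¬ (a % 2 = 0 ∧ b % 2 = 0) := by
    rintro ⟨h, h'⟩
    have := dvd_add (dvd_pow (Int.dvd_of_emod_eq_zero h) two_ne_zero)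
      (dvd_pow (Int.dvd_of_emod_eq_zero h') two_ne_zero)
    lia
  lia

theorem GaussianInt.six_dvd_re_or_im (z : GaussianInt) (h2 : ¬ 2 ∣ z.norm) (h3 : ¬ 3 ∣ z.norm)
    (hadm : ∀ p ∈ admissiblePrimes, ¬ (p : ℤ) ∣ z.norm) : 6 ∣ z.re ∨ 6 ∣ z.im := by
  induction z using UniqueFactorizationMonoid.induction_on_prime with
  | h₁ => simp
  | h₂ x hx => rcases GaussianInt.isUnit_cases hx with rfl | rfl | rfl | rfl <;> simp
  | h₃ w π hw hπ ih =>
    rw [Zsqrtd.norm_mul] at h2 h3 hadm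
    have hw' := ih (fun h => h2 (h.mul_left _)) (fun h => h3 (h.mul_left _))
      (fun p hp h => hadm p hp (h.mul_left _))
    replace h2 : ¬ 2 ∣ π.norm := fun h => h2 (h.mul_right _)
    replace h3 : ¬ 3 ∣ π.norm := fun h => h3 (h.mul_right _)
    replace hadm : ∀ p ∈ admissiblePrimes, ¬ (p : ℤ) ∣ π.norm :=
      fun p hp h => hadm p hp (h.mul_right _)
    have hπ' : 6 ∣ π.re ∨ 6 ∣ π.im := by
      have hn0 : π.norm.natAbs ≠ 0 := by
        rw [Int.natAbs_ne_zero, Ne, GaussianInt.norm_eq_zero]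
        exact hπ.ne_zero
      have hdvd : π ∣ ((π.norm.natAbs.primeFactorsList.map (fun n : ℕ => (n : GaussianInt))).prod) := by
        rw [← Nat.cast_list_prod, Nat.prod_primeFactorsList hn0, GaussianInt.natCast_natAbs_norm,
          Zsqrtd.norm_eq_mul_conj]
        exact dvd_mul_right _ _
      obtain ⟨_, hp, hπp⟩ := (Prime.dvd_prod_iff hπ).1 hdvd
      obtain ⟨p, hpl, rfl⟩ := List.mem_map.1 hp
      obtain ⟨hp, hpn⟩ := (Nat.mem_primeFactorsList hn0).1 hpl
      obtain ⟨β, hβ⟩ := hπp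
      have hN : π.norm.natAbs * β.norm.natAbs = p ^ 2 := by
        rw [← Int.natAbs_mul, ← Zsqrtd.norm_mul, ← hβ, Zsqrtd.norm_natCast, Int.natAbs_mul,
          Int.natAbs_natCast, pow_two]
      have hpn' : (p : ℤ) ∣ π.norm := Int.natCast_dvd.2 hpn
      obtain ⟨i, hi, hpi⟩ := (Nat.dvd_prime_pow hp).1 ⟨_, hN.symm⟩
      have hπ1 : π.norm.natAbs ≠ 1 := by
        rw [Ne, Zsqrtd.norm_eq_one_iff]; exact hπ.not_isUnit
      interval_cases i
      · exact absurd hpi (by simpa using hπ1)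
      · have hpi' : (p : ℤ) = π.re ^ 2 + π.im ^ 2 := by
          have h1 := GaussianInt.abs_natCast_norm π
          rw [hpi, pow_one, Zsqrtd.norm_def] at h1
          rw [h1]; ring
        refine six_dvd_or_of_sq_add_sq_prime hp ?_ ?_ (fun h => hadm p h hpn') hpi'
        · rintro rfl; exact h2 hpn'
        · rintro rfl; exact h3 hpn'
      · have hβ1 : IsUnit β := by
          rw [← Zsqrtd.norm_eq_one_iff]
          rw [hpi] at hN
          exact mul_left_cancel₀ (pow_ne_zero 2 hp.ne_zero) (hN.trans (mul_one _).symm)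
        rw [Zsqrtd.ext_iff] at hβ
        rcases GaussianInt.isUnit_cases hβ1 with rfl | rfl | rfl | rfl <;> simp at hβ <;> lia
    rw [Zsqrtd.re_mul, Zsqrtd.im_mul]
    obtain ⟨x, y⟩ := π
    obtain ⟨x', y'⟩ := w
    simp only at hπ' hw' ⊢
    rcases hπ' with ⟨k, rfl⟩ | ⟨k, rfl⟩ <;> rcases hw' with ⟨l, rfl⟩ | ⟨l, rfl⟩
    · exact Or.inr ⟨k * y' + y * l, by ring⟩
    · exact Or.inl ⟨k * x' - y * l, by ring⟩
    · exact Or.inl ⟨x * l - k * y', by ring⟩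
    · exact Or.inr ⟨x * l + k * x', by ring⟩

theorem six_dvd_or_of_sq_add_sq {a b : ℤ} (h2 : ¬ 2 ∣ a ^ 2 + b ^ 2) (h3 : ¬ 3 ∣ a ^ 2 + b ^ 2)
    (hadm : ∀ p ∈ admissiblePrimes, ¬ (p : ℤ) ∣ a ^ 2 + b ^ 2) : 6 ∣ a ∨ 6 ∣ b := by
  have h : Zsqrtd.norm (⟨a, b⟩ : GaussianInt) = a ^ 2 + b ^ 2 := by rw [Zsqrtd.norm_def]; ring
  exact GaussianInt.six_dvd_re_or_im ⟨a, b⟩ (h ▸ h2) (h ▸ h3) (h ▸ hadm)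

/-! ### Constraints on the values -/

theorem relNormRe_modEq {n a₀ a₁ b₀ b₁ c₀ c₁ d₀ d₁ : ℤ} (h₀ : a₀ ≡ c₀ [ZMOD n])
    (h₁ : a₁ ≡ c₁ [ZMOD n]) (h₂ : b₀ ≡ d₀ [ZMOD n]) (h₃ : b₁ ≡ d₁ [ZMOD n]) :
    relNormRe a₀ a₁ b₀ b₁ ≡ relNormRe c₀ c₁ d₀ d₁ [ZMOD n] := by
  simp only [relNormRe, eisNorm]
  gcongr

theorem relNormIm_modEq {n a₀ a₁ b₀ b₁ c₀ c₁ d₀ d₁ : ℤ} (h₀ : a₀ ≡ c₀ [ZMOD n])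
    (h₁ : a₁ ≡ c₁ [ZMOD n]) (h₂ : b₀ ≡ d₀ [ZMOD n]) (h₃ : b₁ ≡ d₁ [ZMOD n]) :
    relNormIm a₀ a₁ b₀ b₁ ≡ relNormIm c₀ c₁ d₀ d₁ [ZMOD n] := by
  simp only [relNormIm]
  gcongr

theorem eisNorm_modEq_three {a b : ℤ} : eisNorm a b ≡ (a + b) ^ 2 [ZMOD 3] :=
  (Int.modEq_iff_dvd.2 ⟨a * b, by rw [eisNorm]; ring⟩)

theorem two_dvd_of_two_dvd_eisNorm {a b : ℤ} (h : 2 ∣ eisNorm a b) : 2 ∣ a ∧ 2 ∣ b := by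
  exact_mod_cast dvd_of_dvd_eisNorm Nat.prime_two rfl (by exact_mod_cast h)

theorem three_dvd_of_three_dvd_sq_add_sq {a b : ℤ} (h : 3 ∣ a ^ 2 + b ^ 2) : 3 ∣ a ∧ 3 ∣ b := by
  have hx : a % 3 = 0 ∨ a % 3 = 1 ∨ a % 3 = 2 := by lia
  have hy : b % 3 = 0 ∨ b % 3 = 1 ∨ b % 3 = 2 := by lia
  replace h : (a ^ 2 + b ^ 2) % 3 = 0 := by lia
  rcases hx with hx | hx | hx <;> rcases hy with hy | hy | hy <;>
    simp [pow_two, Int.add_emod, Int.mul_emod, hx, hy] at h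
  lia

theorem eisNorm_emod_four_of_forall {k : ℤ} {a b : ℤ} (hk : eisNorm a b = k) (h2 : ¬ 2 ∣ k)
    (h3 : ¬ 3 ∣ k) (hadm : ∀ p ∈ admissiblePrimes, ¬ (p : ℤ) ∣ k) : k % 4 = 1 := by
  obtain ⟨n, rfl⟩ := Int.eq_ofNat_of_zero_le (hk ▸ eisNorm_nonneg a b)
  have := eisNorm_mod_four hk (by lia) (by lia) fun q hq hqn h7 =>
    hadm q ⟨hq, Or.inr (Or.inl h7)⟩ (Int.natCast_dvd_natCast.2 hqn)
  lia

namespace CharData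

variable (d : CharData)

theorem re_modEq_two : d.re ≡ relNormRe d.s₀ d.s₁ d.t₀ d.t₁ [ZMOD 2] :=
  relNormRe_modEq (Int.modEq_iff_dvd.2 d.two_dvd_s₀) (Int.modEq_iff_dvd.2 d.two_dvd_s₁)
    (Int.modEq_iff_dvd.2 d.two_dvd_t₀) (Int.modEq_iff_dvd.2 d.two_dvd_t₁)

theorem im_modEq_two : d.im ≡ relNormIm d.s₀ d.s₁ d.t₀ d.t₁ [ZMOD 2] :=
  relNormIm_modEq (Int.modEq_iff_dvd.2 d.two_dvd_s₀) (Int.modEq_iff_dvd.2 d.two_dvd_s₁)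
    (Int.modEq_iff_dvd.2 d.two_dvd_t₀) (Int.modEq_iff_dvd.2 d.two_dvd_t₁)

/-- Modulo `4`, `eis` is the difference of the squares of the coordinates of the relative norm of
`s + t i`, which is congruent to that of `a + b i` modulo `2`. -/
theorem eis_eq_sq_sub_sq : d.eis = relNormRe d.s₀ d.s₁ d.t₀ d.t₁ ^ 2 -
    relNormIm d.s₀ d.s₁ d.t₀ d.t₁ ^ 2 + 4 * (eisNorm d.s₀ d.s₁ * eisNorm d.t₀ d.t₁) := by
  simp only [eis, relNormRe, relNormIm, eisNorm]; ring

theorem eis_emod_four (h : d.eis % 2 = 1) :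
    (d.eis % 4 = 1 ∧ d.re % 2 = 1 ∧ d.im % 2 = 0) ∨
      (d.eis % 4 = 3 ∧ d.re % 2 = 0 ∧ d.im % 2 = 1) := by
  have hr := d.re_modEq_two
  have hi := d.im_modEq_two
  have he := d.eis_eq_sq_sub_sq
  generalize relNormRe d.s₀ d.s₁ d.t₀ d.t₁ = R at *
  generalize relNormIm d.s₀ d.s₁ d.t₀ d.t₁ = I at *
  generalize eisNorm d.s₀ d.s₁ * eisNorm d.t₀ d.t₁ = m at *
  rw [Int.ModEq] at hr hi
  rcases Int.even_or_odd' R with ⟨k, hk | hk⟩ <;> rcases Int.even_or_odd' I with ⟨l, hl | hl⟩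
  · have : d.eis = 4 * (k ^ 2 - l ^ 2 + m) := by rw [he, hk, hl]; ring
    lia
  · have : d.eis = 4 * (k ^ 2 - l ^ 2 - l + m) - 1 := by rw [he, hk, hl]; ring
    lia
  · have : d.eis = 4 * (k ^ 2 + k - l ^ 2 + m) + 1 := by rw [he, hk, hl]; ring
    lia
  · have : d.eis = 4 * (k ^ 2 + k - l ^ 2 - l + m) := by rw [he, hk, hl]; ring
    lia

/-- If `2`, which is inert in `ℤ[ω]`, divides the norm of `s + t` or of `s - t`, then it divides both
elements. -/
theorem of_two_dvd_eis (h : 2 ∣ d.eis) : 16 ∣ d.eis ∧ 2 ∣ d.re ∧ 2 ∣ d.im := by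
  obtain ⟨hs, ht⟩ : 2 ∣ d.s₀ + d.t₀ ∧ 2 ∣ d.s₁ + d.t₁ := by
    rcases Int.prime_two.dvd_or_dvd h with h | h <;> have := two_dvd_of_two_dvd_eisNorm h <;> lia
  have key {a b : ℤ} (ha : 2 ∣ a) (hb : 2 ∣ b) : 4 ∣ eisNorm a b := by
    obtain ⟨k, rfl⟩ := ha
    obtain ⟨l, rfl⟩ := hb
    exact ⟨eisNorm k l, by simp only [eisNorm]; ring⟩
  refine ⟨mul_dvd_mul (a := 4) (c := 4) (key hs ht) (key (by lia) (by lia)), ?_, ?_⟩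
  · have h1 : d.re ≡ relNormRe d.s₀ d.s₁ d.s₀ d.s₁ [ZMOD 2] :=
      d.re_modEq_two.trans (relNormRe_modEq rfl rfl (Int.modEq_iff_dvd.2 (by lia))
        (Int.modEq_iff_dvd.2 (by lia)))
    rw [relNormRe, sub_self] at h1
    exact Int.modEq_zero_iff_dvd.1 h1
  · have h1 : d.im ≡ relNormIm d.s₀ d.s₁ d.s₀ d.s₁ [ZMOD 2] :=
      d.im_modEq_two.trans (relNormIm_modEq rfl rfl (Int.modEq_iff_dvd.2 (by lia))
        (Int.modEq_iff_dvd.2 (by lia)))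
    refine Int.modEq_zero_iff_dvd.1 (h1.trans (Int.modEq_zero_iff_dvd.2 ⟨eisNorm d.s₀ d.s₁, ?_⟩))
    rw [relNormIm, eisNorm]; ring

theorem re_modEq_three : d.re ≡ d.u ^ 2 - d.v ^ 2 [ZMOD 3] := by
  have hu : d.a₀ + d.a₁ ≡ d.u [ZMOD 3] := Int.modEq_iff_dvd.2 (by have := d.three_dvd_u; lia)
  have hv : d.b₀ + d.b₁ ≡ d.v [ZMOD 3] := Int.modEq_iff_dvd.2 (by have := d.three_dvd_v; lia)
  exact (eisNorm_modEq_three.trans (hu.pow 2)).sub (eisNorm_modEq_three.trans (hv.pow 2))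

theorem im_modEq_three : d.im ≡ 2 * d.u * d.v [ZMOD 3] := by
  have hu : d.a₀ + d.a₁ ≡ d.u [ZMOD 3] := Int.modEq_iff_dvd.2 (by have := d.three_dvd_u; lia)
  have hv : d.b₀ + d.b₁ ≡ d.v [ZMOD 3] := Int.modEq_iff_dvd.2 (by have := d.three_dvd_v; lia)
  have h1 : d.im ≡ 2 * (d.a₀ + d.a₁) * (d.b₀ + d.b₁) [ZMOD 3] :=
    Int.modEq_iff_dvd.2 ⟨d.a₀ * d.b₁ + d.a₁ * d.b₀, by rw [im, relNormIm]; ring⟩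
  exact h1.trans ((hu.mul_left 2).mul hv)

theorem relNorm_modEq_three : d.re ^ 2 + d.im ^ 2 ≡ (d.u ^ 2 + d.v ^ 2) ^ 2 [ZMOD 3] := by
  refine ((d.re_modEq_three.pow 2).add (d.im_modEq_three.pow 2)).trans ?_
  rw [show (d.u ^ 2 - d.v ^ 2) ^ 2 + (2 * d.u * d.v) ^ 2 = (d.u ^ 2 + d.v ^ 2) ^ 2 by ring]

theorem eis_modEq_three : d.eis ≡ (d.p ^ 2 - d.q ^ 2) ^ 2 [ZMOD 3] := by
  have h1 : d.s₀ + d.t₀ + (d.s₁ + d.t₁) ≡ d.p + d.q [ZMOD 3] :=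
    Int.modEq_iff_dvd.2 (by have := d.three_dvd_p; have := d.three_dvd_q; lia)
  have h2 : d.s₀ - d.t₀ + (d.s₁ - d.t₁) ≡ d.p - d.q [ZMOD 3] :=
    Int.modEq_iff_dvd.2 (by have := d.three_dvd_p; have := d.three_dvd_q; lia)
  rw [show (d.p ^ 2 - d.q ^ 2) ^ 2 = (d.p + d.q) ^ 2 * (d.p - d.q) ^ 2 by ring]
  exact (eisNorm_modEq_three.trans (h1.pow 2)).mul (eisNorm_modEq_three.trans (h2.pow 2))

theorem three_dvd_eis_iff : 3 ∣ d.eis ↔ 3 ∣ d.p ^ 2 - d.q ^ 2 :=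
  d.eis_modEq_three.dvd_iff.trans (Int.prime_three.dvd_pow_iff_dvd two_ne_zero)

theorem three_dvd_relNorm_iff : 3 ∣ d.re ^ 2 + d.im ^ 2 ↔ 3 ∣ d.u ^ 2 + d.v ^ 2 :=
  d.relNorm_modEq_three.dvd_iff.trans (Int.prime_three.dvd_pow_iff_dvd two_ne_zero)

theorem eis_dvd_det : d.eis ∣ d.det :=
  ⟨(d.p ^ 2 - d.q ^ 2) * (d.u ^ 2 + d.v ^ 2) * (d.re ^ 2 + d.im ^ 2), by rw [det]; ring⟩

theorem sq_add_sq_dvd_det : d.u ^ 2 + d.v ^ 2 ∣ d.det :=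
  ⟨(d.p ^ 2 - d.q ^ 2) * d.eis * (d.re ^ 2 + d.im ^ 2), by rw [det]; ring⟩

theorem relNorm_dvd_det : d.re ^ 2 + d.im ^ 2 ∣ d.det := ⟨_, mul_comm _ _⟩

/-- The divisibilities by `3` come in pairs, as values at characters that differ by a character of
order `3` are congruent modulo `√-3`. -/
theorem three_dvd_cases (h : 3 ∣ d.det) :
    (3 ∣ d.eis ∧ 3 ∣ d.p ^ 2 - d.q ^ 2) ∨
      (3 ∣ d.u ^ 2 + d.v ^ 2 ∧ 3 ∣ d.re ^ 2 + d.im ^ 2) := by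
  rw [d.three_dvd_eis_iff, d.three_dvd_relNorm_iff, and_self, and_self]
  rw [det] at h
  rcases Int.prime_three.dvd_or_dvd h with h | h
  · rcases Int.prime_three.dvd_or_dvd h with h | h
    · exact Int.prime_three.dvd_or_dvd h
    · exact Or.inl (d.three_dvd_eis_iff.1 h)
  · exact Or.inr (d.three_dvd_relNorm_iff.1 h)

theorem nine_dvd_det (h : 3 ∣ d.det) : 9 ∣ d.det := by
  rcases d.three_dvd_cases h with ⟨h1, h2⟩ | ⟨h1, h2⟩
  · exact (mul_dvd_mul (a := 3) (c := 3) h1 h2).trans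
      ⟨(d.u ^ 2 + d.v ^ 2) * (d.re ^ 2 + d.im ^ 2), by rw [det]; ring⟩
  · exact (mul_dvd_mul (a := 3) (c := 3) h1 h2).trans
      ⟨(d.p ^ 2 - d.q ^ 2) * d.eis, by rw [det]; ring⟩

/-- Otherwise `eis = 3 k` with `k ≡ 1 mod 4`, so `re` is even and hence divisible by `6`, while
`re ≡ u² - v²` modulo `3`, where exactly one of `u` and `v` is divisible by `3`. -/
theorem exists_admissible_of_odd (h2 : ¬ 2 ∣ d.det) (h3 : 3 ∣ d.det) (h27 : ¬ 27 ∣ d.det) :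
    ∃ p ∈ admissiblePrimes, (p : ℤ) ∣ d.det := by
  by_contra! hadm
  have huv3 : ¬ 3 ∣ d.u ^ 2 + d.v ^ 2 := by
    intro h
    have hnine {a b : ℤ} (h : 3 ∣ a ^ 2 + b ^ 2) : 9 ∣ a ^ 2 + b ^ 2 := by
      obtain ⟨⟨k, rfl⟩, l, rfl⟩ := three_dvd_of_three_dvd_sq_add_sq h
      exact ⟨k ^ 2 + l ^ 2, by ring⟩
    have h81 := mul_dvd_mul (hnine h) (hnine (d.three_dvd_relNorm_iff.2 h))
    refine h27 (((by norm_num : (27 : ℤ) ∣ 9 * 9).trans h81).trans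
      ⟨(d.p ^ 2 - d.q ^ 2) * d.eis, by rw [det]; ring⟩)
  have hri3 : ¬ 3 ∣ d.re ^ 2 + d.im ^ 2 := fun h => huv3 (d.three_dvd_relNorm_iff.1 h)
  obtain ⟨⟨k, hk⟩, m, hm⟩ := (d.three_dvd_cases h3).resolve_right fun h => huv3 h.1
  have hk3 : ¬ 3 ∣ k := by
    rintro ⟨l, rfl⟩
    exact h27 ⟨m * (d.u ^ 2 + d.v ^ 2) * l * (d.re ^ 2 + d.im ^ 2), by rw [det, hk, hm]; ring⟩
  obtain ⟨a, b, hab⟩ := exists_eisNorm_eq_of_three_mul ((eisNorm_mul _ _ _ _).symm.trans hk)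
  have hkd : k ∣ d.det := (Dvd.intro_left 3 hk.symm).trans d.eis_dvd_det
  have hk4 := eisNorm_emod_four_of_forall hab (fun h => h2 (h.trans hkd)) hk3
    fun p hp h => hadm p hp (h.trans hkd)
  have hpar := d.eis_emod_four (by lia)
  have h6 := six_dvd_or_of_sq_add_sq (fun h => h2 (h.trans d.sq_add_sq_dvd_det)) huv3
    fun p hp h => hadm p hp (h.trans d.sq_add_sq_dvd_det)
  have h6' := six_dvd_or_of_sq_add_sq (fun h => h2 (h.trans d.relNorm_dvd_det)) hri3
    fun p hp h => hadm p hp (h.trans d.relNorm_dvd_det)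
  have hre3 : 3 ∣ d.re := by lia
  have h0 : 3 ∣ d.u ^ 2 - d.v ^ 2 := d.re_modEq_three.dvd_iff.1 hre3
  have hu : 3 ∣ d.u → 3 ∣ d.u ^ 2 := fun h => dvd_pow h two_ne_zero
  have hv : 3 ∣ d.v → 3 ∣ d.v ^ 2 := fun h => dvd_pow h two_ne_zero
  lia

theorem sixty_four_dvd_det (h : 2 ∣ d.eis * (d.re ^ 2 + d.im ^ 2)) : 64 ∣ d.det := by
  have he : 2 ∣ d.eis := by
    by_contra he
    have hpar := d.eis_emod_four (by lia)
    have h1 := (Int.prime_two.dvd_or_dvd h).resolve_left he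
    rcases Int.even_or_odd' d.re with ⟨k, hk | hk⟩ <;>
      rcases Int.even_or_odd' d.im with ⟨l, hl | hl⟩ <;> try lia
    · rw [hk, hl, show (2 * k) ^ 2 + (2 * l + 1) ^ 2 = 2 * (2 * k ^ 2 + 2 * l ^ 2 + 2 * l) + 1 by
        ring] at h1
      lia
    · rw [hk, hl, show (2 * k + 1) ^ 2 + (2 * l) ^ 2 = 2 * (2 * k ^ 2 + 2 * k + 2 * l ^ 2) + 1 by
        ring] at h1
      lia
  obtain ⟨⟨m, hm⟩, ⟨k, hk⟩, l, hl⟩ := d.of_two_dvd_eis he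
  exact ⟨(d.p ^ 2 - d.q ^ 2) * (d.u ^ 2 + d.v ^ 2) * m * (k ^ 2 + l ^ 2), by
    rw [det, hm, hk, hl]; ring⟩

/-- The `2`-adic analysis of the values at the characters of `C₄`. In the second part, the Gaussian
integer `u + v i` is `r (1 + i) (c + e i)` with `c + e i` of odd norm. -/
theorem two_adic_cases (h : 2 ∣ (d.p ^ 2 - d.q ^ 2) * (d.u ^ 2 + d.v ^ 2)) :
    16 ∣ (d.p ^ 2 - d.q ^ 2) * (d.u ^ 2 + d.v ^ 2) ∧
      (32 ∣ (d.p ^ 2 - d.q ^ 2) * (d.u ^ 2 + d.v ^ 2) →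
        ¬ 64 ∣ (d.p ^ 2 - d.q ^ 2) * (d.u ^ 2 + d.v ^ 2) →
        ∃ r c e : ℤ, d.u = r * (c - e) ∧ d.v = r * (c + e) ∧ ¬ 2 ∣ c ^ 2 + e ^ 2) := by
  obtain ⟨k, hk⟩ := d.two_dvd_p
  obtain ⟨l, hl⟩ := d.two_dvd_q
  have hpar : d.u % 2 = d.v % 2 := by
    by_contra hne
    rw [← even_iff_two_dvd] at h
    simp only [Int.even_mul, Int.even_sub, Int.even_add, Int.even_pow] at h
    simp only [Int.even_iff] at h
    lia
  rcases Int.even_or_odd' d.u with ⟨x, hx | hx⟩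
  · obtain ⟨y, hy⟩ : 2 ∣ d.v := by lia
    have hM : (d.p ^ 2 - d.q ^ 2) * (d.u ^ 2 + d.v ^ 2) =
        16 * (((x + k) ^ 2 - (y + l) ^ 2) * (x ^ 2 + y ^ 2)) := by
      rw [show d.p = 2 * (x + k) by lia, show d.q = 2 * (y + l) by lia, hx, hy]; ring
    rw [hM]
    refine ⟨dvd_mul_right _ _, fun h32 h64 => ?_⟩
    have hodd : ¬ 2 ∣ (x + k) + (y + l) := by
      rintro ⟨m, hm⟩
      refine h64 ⟨m * (m - (y + l)) * (x ^ 2 + y ^ 2), ?_⟩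
      rw [show x + k = 2 * m - (y + l) by lia]
      ring
    have hxy : x % 2 = y % 2 := by
      have h2 : 2 ∣ ((x + k) ^ 2 - (y + l) ^ 2) * (x ^ 2 + y ^ 2) := by lia
      rw [← even_iff_two_dvd] at h2
      simp only [Int.even_mul, Int.even_sub, Int.even_add, Int.even_pow] at h2
      simp only [Int.even_iff] at h2
      lia
    obtain ⟨c, hc⟩ : 2 ∣ x + y := by lia
    refine ⟨2, c, y - c, by lia, by lia, ?_⟩
    rintro ⟨m, hm⟩
    refine h64 ⟨((x + k) ^ 2 - (y + l) ^ 2) * m, ?_⟩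
    have hs : x ^ 2 + y ^ 2 = 4 * m := by
      rw [show x = 2 * c - y by lia]
      linear_combination 2 * hm
    rw [hs]
    ring
  · obtain ⟨y, hy⟩ : ∃ y, d.v = 2 * y + 1 := ⟨d.v / 2, by lia⟩
    constructor
    · obtain ⟨m, hm⟩ := Int.eight_dvd_sq_sub_one_of_odd (k := d.p) ⟨x + k, by lia⟩
      obtain ⟨n, hn⟩ := Int.eight_dvd_sq_sub_one_of_odd (k := d.q) ⟨y + l, by lia⟩
      refine ⟨(m - n) * (2 * x ^ 2 + 2 * x + 2 * y ^ 2 + 2 * y + 1), ?_⟩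
      rw [show d.p ^ 2 - d.q ^ 2 = 8 * (m - n) by lia, hx, hy]
      ring
    · refine fun _ _ => ⟨1, x + y + 1, y - x, by lia, by lia, ?_⟩
      rw [← even_iff_two_dvd]
      simp only [Int.even_add, Int.even_pow]
      simp only [Int.even_iff]
      lia

theorem sixteen_dvd_det (h : 2 ∣ d.det) : 16 ∣ d.det := by
  by_cases h1 : 2 ∣ d.eis * (d.re ^ 2 + d.im ^ 2)
  · exact (by norm_num : (16 : ℤ) ∣ 64).trans (d.sixty_four_dvd_det h1)
  · rw [det, mul_assoc] at h ⊢
    exact (d.two_adic_cases ((Int.prime_two.dvd_or_dvd h).resolve_right h1)).1.mul_right _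

/-- Otherwise `c + e i` is a unit modulo `6`, so `re ≡ u² - v²` is divisible by `3`, hence by `6`; then
`eis ≡ 3 mod 4`, although `eis` is a norm without prime factors `7` modulo `12`. -/
theorem exists_admissible_of_even (h3 : ¬ 3 ∣ d.det) (h32 : 32 ∣ d.det) (h64 : ¬ 64 ∣ d.det) :
    ∃ p ∈ admissiblePrimes, (p : ℤ) ∣ d.det := by
  by_contra! hadm
  have hodd : ¬ 2 ∣ d.eis * (d.re ^ 2 + d.im ^ 2) := fun h => h64 (d.sixty_four_dvd_det h)
  have he2 : ¬ 2 ∣ d.eis := fun h => hodd (h.mul_right _)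
  have hr2 : ¬ 2 ∣ d.re ^ 2 + d.im ^ 2 := fun h => hodd (h.mul_left _)
  have hM : d.det = (d.p ^ 2 - d.q ^ 2) * (d.u ^ 2 + d.v ^ 2) *
      (d.eis * (d.re ^ 2 + d.im ^ 2)) := by rw [det]; ring
  have h32' : 32 ∣ (d.p ^ 2 - d.q ^ 2) * (d.u ^ 2 + d.v ^ 2) := by
    rw [hM] at h32
    refine IsCoprime.dvd_of_dvd_mul_right ?_ h32
    exact IsCoprime.pow_left (m := 5) (x := (2 : ℤ))
      ((Int.prime_two.coprime_iff_not_dvd).2 hodd)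
  obtain ⟨r, c, e, hu, hv, hce⟩ := (d.two_adic_cases (Dvd.dvd.trans (by norm_num) h32')).2 h32'
    fun h => h64 (hM ▸ h.mul_right _)
  have hced : c ^ 2 + e ^ 2 ∣ d.det :=
    Dvd.dvd.trans ⟨2 * r ^ 2, by rw [hu, hv]; ring⟩ d.sq_add_sq_dvd_det
  have h6 := six_dvd_or_of_sq_add_sq hce (fun h => h3 (h.trans hced))
    fun p hp h => hadm p hp (h.trans hced)
  have h6' := six_dvd_or_of_sq_add_sq hr2 (fun h => h3 (h.trans d.relNorm_dvd_det))
    fun p hp h => hadm p hp (h.trans d.relNorm_dvd_det)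
  have hre3 : 3 ∣ d.re := by
    refine d.re_modEq_three.dvd_iff.2 ?_
    rw [hu, hv, show (r * (c - e)) ^ 2 - (r * (c + e)) ^ 2 = -4 * r ^ 2 * (c * e) by ring]
    refine Dvd.dvd.mul_left ?_ _
    rcases h6 with h | h
    · exact (Dvd.dvd.trans (by norm_num) h).mul_right e
    · exact (Dvd.dvd.trans (by norm_num) h).mul_left c
  have h0 : ¬ (3 ∣ d.re ∧ 3 ∣ d.im) := by
    rintro ⟨h, h'⟩
    exact h3 ((dvd_add (dvd_pow h two_ne_zero) (dvd_pow h' two_ne_zero)).trans d.relNorm_dvd_det)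
  have hpar := d.eis_emod_four (by lia)
  have hk4 := eisNorm_emod_four_of_forall (eisNorm_mul _ _ _ _).symm he2
    (fun h => h3 (Dvd.dvd.trans h d.eis_dvd_det)) fun p hp h => hadm p hp (h.trans d.eis_dvd_det)
  change d.eis % 4 = 1 at hk4
  lia

end CharData

/-! ### The set of values -/

theorem isCoprime_two_iff {n : ℤ} : IsCoprime n 2 ↔ ¬ 2 ∣ n := by
  rw [isCoprime_comm, Int.prime_two.coprime_iff_not_dvd]

theorem isCoprime_three_iff {n : ℤ} : IsCoprime n 3 ↔ ¬ 3 ∣ n := by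
  rw [isCoprime_comm, Int.prime_three.coprime_iff_not_dvd]

theorem isCoprime_six_iff {n : ℤ} : IsCoprime n 6 ↔ ¬ 2 ∣ n ∧ ¬ 3 ∣ n := by
  rw [show (6 : ℤ) = 2 * 3 by norm_num, IsCoprime.mul_right_iff, isCoprime_two_iff,
    isCoprime_three_iff]

theorem isCoprime_six_of_mem_admissiblePrimes {p : ℕ} (hp : p ∈ admissiblePrimes) :
    IsCoprime (p : ℤ) 6 := by
  have : p % 12 = 5 ∨ p % 12 = 7 ∨ p % 12 = 1 := by
    rcases hp with ⟨_, h | h | h⟩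
    · exact Or.inl h
    · exact Or.inr (Or.inl h)
    · exact Or.inr (Or.inr h.2.1)
  rw [isCoprime_six_iff]
  lia

/-- An admissible prime dividing `c * k`, where `c` has no prime factors besides `2` and `3`,
divides `k`. -/
theorem dvd_of_dvd_mul_of_mem_admissiblePrimes {p : ℕ} (hp : p ∈ admissiblePrimes) {c k : ℤ} (j : ℕ)
    (hc : c ∣ 6 ^ j) (h : (p : ℤ) ∣ c * k) : (p : ℤ) ∣ k :=
  (((isCoprime_six_of_mem_admissiblePrimes hp).pow_right (n := j)).of_isCoprime_of_dvd_right
    hc).dvd_of_dvd_mul_left h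

theorem theorem5p3 :
    {n ∈ groupDetValues (Multiplicative (ZMod 12)) | Odd n ∧ IsCoprime n 3} =
        {n : ℤ | IsCoprime n 6} ∧
    {n ∈ groupDetValues (Multiplicative (ZMod 12)) | Odd n ∧ 3 ∣ n} =
        {n : ℤ | ∃ m : ℤ, ∃ p ∈ admissiblePrimes, IsCoprime m 6 ∧ n = 9 * m * (p : ℤ)} ∪
        {n : ℤ | ∃ m : ℤ, IsCoprime m 2 ∧ n = 27 * m} ∧
    {n ∈ groupDetValues (Multiplicative (ZMod 12)) | Even n ∧ 3 ∣ n} =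
        {n : ℤ | ∃ m : ℤ, n = 2 ^ 4 * 3 ^ 2 * m} ∧
    {n ∈ groupDetValues (Multiplicative (ZMod 12)) | Even n ∧ IsCoprime n 3} =
        {n : ℤ | ∃ m : ℤ, IsCoprime m 6 ∧ n = 2 ^ 4 * m} ∪
        {n : ℤ | ∃ m : ℤ, ∃ p ∈ admissiblePrimes, IsCoprime m 6 ∧ n = 2 ^ 5 * m * (p : ℤ)} ∪
        {n : ℤ | ∃ m : ℤ, IsCoprime m 3 ∧ n = 2 ^ 6 * m} := by
  have hodd (n : ℤ) : Odd n ↔ ¬ 2 ∣ n := by rw [← Int.not_even_iff_odd, even_iff_two_dvd]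
  have hfactor {c n : ℤ} (j : ℕ) (hc : c ∣ 6 ^ j) {k : ℤ} (hk : n = c * k) (hk6 : IsCoprime k 6)
      (h : ∃ p ∈ admissiblePrimes, (p : ℤ) ∣ n) :
      ∃ m : ℤ, ∃ p ∈ admissiblePrimes, IsCoprime m 6 ∧ n = c * m * (p : ℤ) := by
    obtain ⟨p, hp, hpn⟩ := h
    obtain ⟨m, rfl⟩ := dvd_of_dvd_mul_of_mem_admissiblePrimes hp j hc (hk ▸ hpn)
    exact ⟨m, p, hp, hk6.of_mul_left_right, by rw [hk]; ring⟩
  refine ⟨?_, ?_, ?_, ?_⟩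
  · ext n
    simp only [Set.mem_ofPred_eq, hodd, isCoprime_three_iff]
    exact ⟨fun h => isCoprime_six_iff.2 h.2, fun h =>
      ⟨mem_groupDetValues_of_isCoprime_six h, isCoprime_six_iff.1 h⟩⟩
  · ext n
    simp only [Set.mem_ofPred_eq, Set.mem_union, hodd]
    constructor
    · rintro ⟨hn, h2, h3⟩
      obtain ⟨d, rfl⟩ := mem_groupDetValues_iff.1 hn
      by_cases h27 : 27 ∣ d.det
      · obtain ⟨m, hm⟩ := h27
        exact Or.inr ⟨m, isCoprime_two_iff.2 (by lia), hm⟩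
      · obtain ⟨k, hk⟩ := d.nine_dvd_det h3
        exact Or.inl (hfactor 2 (by norm_num) hk (isCoprime_six_iff.2 (by lia))
          (d.exists_admissible_of_odd h2 h3 h27))
    · rintro (⟨m, p, hp, hm, rfl⟩ | ⟨m, hm, rfl⟩)
      · refine ⟨?_, ?_, ?_⟩
        · have := neg_mem_groupDetValues (mul_mem_groupDetValues (mem_groupDetValues_of_isCoprime_six hm) (neg_nine_mul_mem_groupDetValues hp))
          convert this using 1; ring
        · have := (isCoprime_six_iff.1 (hm.mul_left (isCoprime_six_of_mem_admissiblePrimes hp))).1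
          rw [mul_assoc]; lia
        · rw [mul_assoc]; lia
      · exact ⟨mul_27_mem_groupDetValues hm, by have := isCoprime_two_iff.1 hm; lia, by lia⟩
  · ext n
    simp only [Set.mem_ofPred_eq, even_iff_two_dvd]
    constructor
    · rintro ⟨hn, h2, h3⟩
      obtain ⟨d, rfl⟩ := mem_groupDetValues_iff.1 hn
      have h9 := d.nine_dvd_det h3
      have h16 := d.sixteen_dvd_det h2
      exact ⟨d.det / 144, by lia⟩
    · rintro ⟨m, rfl⟩
      exact ⟨mul_144_mem_groupDetValues m, by lia, by lia⟩
  · ext n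
    simp only [Set.mem_ofPred_eq, Set.mem_union, even_iff_two_dvd, isCoprime_three_iff]
    constructor
    · rintro ⟨hn, h2, h3⟩
      obtain ⟨d, rfl⟩ := mem_groupDetValues_iff.1 hn
      obtain ⟨k, hk⟩ := d.sixteen_dvd_det h2
      by_cases h64 : 64 ∣ d.det
      · exact Or.inr ⟨d.det / 64, by lia, by lia⟩
      · by_cases h32 : 32 ∣ d.det
        · obtain ⟨l, hl⟩ := h32
          exact Or.inl (Or.inr (hfactor 5 (by norm_num) (show d.det = 2 ^ 5 * l by lia)
            (isCoprime_six_iff.2 (by lia))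
            (d.exists_admissible_of_even h3 ⟨l, hl⟩ h64)))
        · exact Or.inl (Or.inl ⟨k, isCoprime_six_iff.2 (by lia), by lia⟩)
    · rintro ((⟨m, hm, rfl⟩ | ⟨m, p, hp, hm, rfl⟩) | ⟨m, hm, rfl⟩)
      · exact ⟨mul_16_mem_groupDetValues hm, by lia, by have := (isCoprime_six_iff.1 hm).2; lia⟩
      · refine ⟨?_, ?_, ?_⟩
        · have := mul_mem_groupDetValues (mem_groupDetValues_of_isCoprime_six hm) (thirty_two_mul_mem_groupDetValues hp)
          convert this using 1; ring
        · rw [mul_assoc]; lia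
        · have := (isCoprime_six_iff.1 (hm.mul_left (isCoprime_six_of_mem_admissiblePrimes hp))).2
          rw [mul_assoc]; lia
      · exact ⟨mul_64_mem_groupDetValues (isCoprime_three_iff.2 hm), by lia, by lia⟩
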